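/- Notation. $\log$ is the logarithm in base $2$, $[x]_b=2^{-b}\lfloor 2^b x\rfloor$ is the $b$-bit quantization of $x\in\mathbb R$ (applied coordinatewise to vectors), $\mathcal X\subset\mathbb R$ is a bounded set and $\mathcal X_b=\{[x]_b:x\in\mathcal X\}$. For $u^n\in\mathcal X_b^n$ let $\hat p^{(k+1)}(a^{k+1}\mid u^n)=\frac1{n-k}\,|\{i: k+1\le i\le n,\ u_{i-k}^{i}=a^{k+1}\}|$. A stationary process $\mathbf X=\{X_i\}_{i\ge1}$ is $\psi^*$-mixing if $\psi^*(g)=\sup \frac{P(\mathcal A\cap\mathcal B)}{P(\mathcal A)P(\mathcal B)}\to1$ as $g\to\infty$, the supremum being over all $j$ and all events $\mathcal A\in\sigma(X_i:i\le j)$, $\mathcal B\in\sigma(X_i:i\ge j+g)$ of positive probability. For a process with values in $\mathcal X$, $\bar d_k=\bar d_k(\mathbf X)=\limsup_{b\to\infty}\frac1b H([X_{k+1}]_b\mid [X^k]_b)$ and $w_{a^{k+1}}=\log\frac1{P([X_{k+1}]_b=a_{k+1}\mid[X^k]_b=a^k)}\in[0,\infty]$ (equal to $\infty$ if this probability vanishes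 or the conditioning event is null; $\infty\cdot0=0$). Corollary. Let $\mathbf X$ be a stationary $\psi^*$-mixing process with values in the bounded set $\mathcal X$, let $k\ge0$, and assume that there is a constant $f_{k+1}>0$ such that $P(X^{k+1}\in S)\ge f_{k+1}|S|$ for every measurable $S\subseteq\mathcal X^{k+1}$ with $P(X^{k+1}\in S)>0$, where $|S|$ is the Lebesgue measure. Let $r>1$, $\delta>0$, $\sigma\ge0$, $b=b_n=\lceil r\log\log n\rceil$, and let $m=m_n$ be $80\,n\,b\,(\bar d_k+\delta)$ rounded (up or down) to an integer. For each $n$ let $Y^m=AX^n+Z^m$, where $A\in\mathbb R^{m\times n}$ has i.i.d. $\mathcal N(0,\frac1n)$ entries, $Z^m$ has i.i.d. $\mathcal N(0,\sigma^2)$ entries, and $\mathbf X$, $A$, $Z^m$ are independent. Let $$\mathcal F_o=\Big\{u^n\in\mathcal X_b^n:\ \sum_{a^{k+1}\in\mathcal X_b^{k+1}}w_{a^{k+1}}\,\hat p^{(k+1)}(a^{k+1}\mid u^n)\le b(\bar d_k+\delta)\Big\},$$ let $\hat X^n(0)=0^n$ and, for $t\ge0$, $$S^n(t+1)=\hat X^n(t)+\tfrac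 nm A^{T}\big(Y^m-A\hat X^n(t)\big),\qquad \hat X^n(t+1)\in\operatorname*{arg\,min}_{u^n\in\mathcal F_o}\|u^n-S^n(t+1)\|,$$ and put $E^n(t)=\hat X^n(t)-[X^n]_b$. Then with probability tending to one as $n\to\infty$ the following holds: the iteration can be carried out ($\mathcal F_o$ is nonempty), and for every choice of the minimizers and simultaneously for all $t\ge1$, $$\frac{\|E^n(t+1)\|}{\sqrt n}\ \le\ 0.9\,\frac{\|E^n(t)\|}{\sqrt n}+\frac{2(\sqrt n+2\sqrt m)^2}{m}\,2^{-b}+\frac{\sigma}{2}\sqrt{\frac{n\,b\,(\bar d_k+3\delta)}{m}} .$$ -/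

import Mathlib

open MeasureTheory ProbabilityTheory Filter Topology
open scoped ENNReal NNReal Matrix

namespace QMAP

noncomputable section

/-! ### Quantization -/

/-- The `b`-bit quantized version `[x]_b` of a real number: the integer part of `x` together with
the first `b` binary digits of its fractional part, that is `⌊2^b x⌋ / 2^b`. -/
def quantize (b : ℕ) (x : ℝ) : ℝ := (⌊(2 : ℝ) ^ b * x⌋ : ℝ) / (2 : ℝ) ^ b

/-- The quantized alphabet `𝒳_b = {[x]_b : x ∈ 𝒳}`. -/
def quantizedAlphabet (𝒳 : Set ℝ) (b : ℕ) : Set ℝ := quantize b '' 𝒳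

/-- Coordinatewise quantization `[x^n]_b` of a vector. -/
def quantizeVec {n : ℕ} (b : ℕ) (x : EuclideanSpace ℝ (Fin n)) : EuclideanSpace ℝ (Fin n) :=
  WithLp.toLp 2 (fun i => quantize b (x i))

/-! ### The source process; `X i` is the `(i+1)`-st variable of the process -/

section Source

variable {Ω : Type*} [MeasurableSpace Ω]

/-- The first `n` variables of the process, as a vector. -/
def block (X : ℕ → Ω → ℝ) (n : ℕ) (ω : Ω) : EuclideanSpace ℝ (Fin n) :=
  WithLp.toLp 2 (fun i : Fin n => X i ω)

/-- Stationarity: the shifted process has the same law as the process. -/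
def IsStationary (μ : Measure Ω) (X : ℕ → Ω → ℝ) : Prop :=
  IdentDistrib (fun ω (i : ℕ) => X (i + 1) ω) (fun ω (i : ℕ) => X i ω) μ μ

/-- The σ-algebra generated by the variables `X i`, `i ∈ I`. -/
abbrev sigmaGen (X : ℕ → Ω → ℝ) (I : Set ℕ) : MeasurableSpace Ω :=
  ⨆ i ∈ I, MeasurableSpace.comap (X i) inferInstance

/-- `ψ*(g) = sup P(𝒜 ∩ ℬ) / (P(𝒜) P(ℬ))`, over all times `j` and all events `𝒜` of the past up to
time `j` and `ℬ` of the future from time `j + g` on, both of positive probability. -/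
def psiStar (μ : Measure Ω) (X : ℕ → Ω → ℝ) (g : ℕ) : ℝ≥0∞ :=
  ⨆ (j : ℕ) (S : Set Ω) (T : Set Ω)
    (_ : MeasurableSet[sigmaGen X (Set.Iic j)] S ∧ MeasurableSet[sigmaGen X (Set.Ici (j + g))] T ∧
      0 < μ S ∧ 0 < μ T),
    μ (S ∩ T) / (μ S * μ T)

/-- A `ψ*`-mixing process: stationary, with `ψ*(g) → 1`. -/
def IsPsiStarMixing (μ : Measure Ω) (X : ℕ → Ω → ℝ) : Prop :=
  IsStationary μ X ∧ Tendsto (psiStar μ X) atTop (𝓝 1)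

/-- `P([X^l]_b = a^l)`. -/
def blockProb (μ : Measure Ω) (X : ℕ → Ω → ℝ) (b l : ℕ) (a : Fin l → ℝ) : ℝ :=
  μ.real {ω | ∀ i : Fin l, quantize b (X i ω) = a i}

/-- `P([X_{k+1}]_b = a_{k+1} | [X^k]_b = a^k)`; it is `0` if the conditioning event is null. -/
def condProb (μ : Measure Ω) (X : ℕ → Ω → ℝ) (b k : ℕ) (a : Fin (k + 1) → ℝ) : ℝ :=
  blockProb μ X b (k + 1) a / blockProb μ X b k (Fin.init a)

/-- The conditional entropy `H([X_{k+1}]_b | [X^k]_b)`, in bits, of a process with values in `𝒳`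
(the alphabet `𝒳_b` is finite when `𝒳` is bounded). -/
def condEntropy (μ : Measure Ω) (X : ℕ → Ω → ℝ) (𝒳 : Set ℝ) (b k : ℕ) : ℝ :=
  -∑' a : Fin (k + 1) → quantizedAlphabet 𝒳 b,
    blockProb μ X b (k + 1) (fun i => (a i : ℝ)) *
      Real.logb 2 (condProb μ X b k (fun i => (a i : ℝ)))

/-- The `k`-th order upper information dimension of the process. -/
def upperInfoDim (μ : Measure Ω) (X : ℕ → Ω → ℝ) (𝒳 : Set ℝ) (k : ℕ) : ℝ :=
  limsup (fun b : ℕ => condEntropy μ X 𝒳 b k / b) atTop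

/-- The weight `w_{a^{k+1}} = log₂ (1 / P([X_{k+1}]_b = a_{k+1} | [X^k]_b = a^k))`, which is `+∞`
when this probability vanishes. -/
def weight (μ : Measure Ω) (X : ℕ → Ω → ℝ) (b k : ℕ) (a : Fin (k + 1) → ℝ) : ℝ≥0∞ :=
  if condProb μ X b k a = 0 then ⊤ else ENNReal.ofReal (Real.logb 2 (1 / condProb μ X b k a))

open Classical in
/-- The `(k+1)`-st order empirical distribution of `u^n`: the fraction of the `n - k` windows of
length `k + 1` of `u^n` that are equal to `a^{k+1}`. -/
def empirical {n : ℕ} (k : ℕ) (u : EuclideanSpace ℝ (Fin n)) (a : Fin (k + 1) → ℝ) : ℝ :=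
  ((Finset.univ.filter fun i : Fin (n - k) =>
      ∀ j : Fin (k + 1), u ⟨i.1 + j.1, by omega⟩ = a j).card : ℝ) / ((n : ℝ) - k)

/-- The cost `∑ w_{a^{k+1}} p̂^{(k+1)}(a^{k+1} | u^n)`, over `a^{k+1} ∈ 𝒳_b^{k+1}`. It lives in
`[0, ∞]`, with `∞ * 0 = 0`. -/
def cost {n : ℕ} (μ : Measure Ω) (X : ℕ → Ω → ℝ) (𝒳 : Set ℝ) (b k : ℕ)
    (u : EuclideanSpace ℝ (Fin n)) : ℝ≥0∞ :=
  ∑' a : Fin (k + 1) → quantizedAlphabet 𝒳 b,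
    weight μ X b k (fun i => (a i : ℝ)) * ENNReal.ofReal (empirical k u (fun i => (a i : ℝ)))

/-- The set `ℱ_o` of all `u^n ∈ 𝒳_b^n` whose cost is at most `γ`. -/
def feasible (μ : Measure Ω) (X : ℕ → Ω → ℝ) (𝒳 : Set ℝ) (b k n : ℕ) (γ : ℝ) :
    Set (EuclideanSpace ℝ (Fin n)) :=
  {u | (∀ i, u i ∈ quantizedAlphabet 𝒳 b) ∧ cost μ X 𝒳 b k u ≤ ENNReal.ofReal γ}

end Source

/-! ### Projected gradient descent -/

/-- The gradient step `x + η Aᵀ (y - A x)`. -/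
def gradStep {m n : ℕ} (A : Matrix (Fin m) (Fin n) ℝ) (y : Fin m → ℝ) (η : ℝ)
    (x : EuclideanSpace ℝ (Fin n)) : EuclideanSpace ℝ (Fin n) :=
  x + η • WithLp.toLp 2 (Aᵀ *ᵥ (y - A *ᵥ x.ofLp))

/-- `x 0, x 1, …` is a sequence produced by projected gradient descent on `F` with step size `η`:
it starts at `0`, and `x (t + 1)` is a point of `F` nearest to the gradient step from `x t`. -/
structure IsPGDRun {m n : ℕ} (F : Set (EuclideanSpace ℝ (Fin n))) (A : Matrix (Fin m) (Fin n) ℝ)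
    (y : Fin m → ℝ) (η : ℝ) (x : ℕ → EuclideanSpace ℝ (Fin n)) : Prop where
  init : x 0 = 0
  mem : ∀ t, x (t + 1) ∈ F
  nearest : ∀ t, ∀ u ∈ F, ‖x (t + 1) - gradStep A y η (x t)‖ ≤ ‖u - gradStep A y η (x t)‖

/-- The quantization level `b_n = ⌈r log₂ log₂ n⌉`. -/
def bits (r : ℝ) (n : ℕ) : ℕ := ⌈r * Real.logb 2 (Real.logb 2 n)⌉₊

end

end QMAP

/-! The measurement count `m` is of order `n b` with `b → ∞`, so `m / n → ∞` and `A` is very tall.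
Hence `(n/m) AᵀA` is close to the identity in operator norm on all of `ℝⁿ`, and the structure of the
feasible set matters only through one fact: with high probability it contains the quantized source
`q`.

If `q` is feasible, the nearest-point property gives `‖x (t+1) - q‖ ≤ 2 ‖s - q‖` for the gradient
step `s`, with no convexity. If `‖(n/m) AᵀA - 1‖ ≤ 2/5`, the previous error is multiplied by at most
`4/5`, the quantization error contributes at most `(14/5) 2^{-b}` after normalization, and the noise
enters through `(n/m) Aᵀ z` (`gradStep_sub`, `IsPGDRun.error_recursion`). All three are below the
terms claimed. The good event does not involve `t` or the choice of minimizers, which gives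
uniformity in both.

Three events must be likely. The near isometry (`measure_gramDefect_gt_le`) comes from a `1/4`-net
of the sphere and chi-square concentration: failure costs `9^n · 2 (199/200)^m`. The noise bound
(`measure_transpose_mulVec_noise_le`) is Markov's inequality with `E‖AᵀZ‖² = m σ²`: failure costs
`O(n/m)`. Feasibility (`tendsto_measure_quantizeVec_notMem_feasible`) is a weak law: the cost of `q`
is the average of the conditional information contents of its windows, with mean the conditional
entropy. Their second moment is `O(b²)`, and `ψ*`-mixing bounds correlations from above, so
Chebyshev's inequality at deviation `b δ / 2` applies uniformly in `b`. -/

namespace QMAP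

/-! ### Quantization and the finite alphabet -/

lemma quantize_le (b : ℕ) (x : ℝ) : quantize b x ≤ x := by
  unfold quantize
  rw [div_le_iff₀ (by positivity), mul_comm x]
  exact Int.floor_le _

lemma sub_quantize_le (b : ℕ) (x : ℝ) : x - quantize b x ≤ (2 : ℝ) ^ (-(b : ℝ)) := by
  unfold quantize
  rw [Real.rpow_neg (by norm_num), Real.rpow_natCast, sub_le_iff_le_add, inv_eq_one_div, ← add_div,
    le_div_iff₀ (by positivity), mul_comm x]
  linarith [Int.lt_floor_add_one ((2 : ℝ) ^ b * x)]

lemma norm_sub_quantizeVec_le {n : ℕ} (b : ℕ) (x : EuclideanSpace ℝ (Fin n)) :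
    ‖x - quantizeVec b x‖ ≤ √(n : ℝ) * (2 : ℝ) ^ (-(b : ℝ)) := by
  rw [EuclideanSpace.norm_eq]
  have h0 : (0 : ℝ) ≤ (2 : ℝ) ^ (-(b : ℝ)) := by positivity
  have : √(n : ℝ) * (2 : ℝ) ^ (-(b : ℝ)) = √(∑ _i : Fin n, ((2 : ℝ) ^ (-(b : ℝ))) ^ 2) := by
    rw [Finset.sum_const, Finset.card_univ, Fintype.card_fin, nsmul_eq_mul,
      Real.sqrt_mul (by positivity), Real.sqrt_sq h0]
  rw [this]
  refine Real.sqrt_le_sqrt (Finset.sum_le_sum fun i _ => ?_)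
  have h1 := quantize_le b (x i)
  have h2 := sub_quantize_le b (x i)
  have h3 : (x - quantizeVec b x) i = x i - quantize b (x i) := rfl
  rw [h3, Real.norm_eq_abs, abs_of_nonneg (by linarith)]
  exact pow_le_pow_left₀ (by linarith) h2 2

lemma measurable_quantize (b : ℕ) : Measurable (quantize b) := by
  unfold quantize
  fun_prop

/-- The quantized alphabet of a bounded set has at most `(2 R + 1) 2^b` elements. -/
lemma exists_card_quantizedAlphabet_le {𝒳 : Set ℝ} (h𝒳 : Bornology.IsBounded 𝒳) :
    ∃ R : ℕ, ∀ b, (quantizedAlphabet 𝒳 b).Finite ∧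
      (quantizedAlphabet 𝒳 b).ncard ≤ (2 * R + 1) * 2 ^ b := by
  obtain ⟨C, hC⟩ := h𝒳.exists_norm_le
  obtain ⟨R, hR⟩ := exists_nat_ge C
  refine ⟨R, fun b => ?_⟩
  set I : Finset ℤ := Finset.Icc (-(2 ^ b * R : ℤ)) (2 ^ b * R)
  have hsub : quantizedAlphabet 𝒳 b ⊆
      (I.image fun z : ℤ => (z : ℝ) / (2 : ℝ) ^ b : Finset ℝ) := by
    rintro _ ⟨x, hx, rfl⟩
    have h1 : |x| ≤ R := (hC x hx).trans hR
    rw [abs_le] at h1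
    have hp : (0 : ℝ) < 2 ^ b := by positivity
    simp only [Finset.coe_image, Set.mem_image, Finset.mem_coe, I, Finset.mem_Icc]
    refine ⟨⌊(2 : ℝ) ^ b * x⌋, ⟨?_, ?_⟩, rfl⟩
    · rw [Int.le_floor]; push_cast; nlinarith
    · have : ((⌊(2 : ℝ) ^ b * x⌋ : ℤ) : ℝ) ≤ ((2 ^ b * R : ℤ) : ℝ) :=
        (Int.floor_le _).trans (by push_cast; nlinarith)
      exact_mod_cast this
  refine ⟨(Finset.finite_toSet _).subset hsub, ?_⟩
  calc (quantizedAlphabet 𝒳 b).ncard ≤ (I.image fun z : ℤ => (z : ℝ) / (2 : ℝ) ^ b).card := by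
        rw [← Set.ncard_coe_finset]
        exact Set.ncard_le_ncard hsub (Finset.finite_toSet _)
    _ ≤ I.card := Finset.card_image_le
    _ = 2 * (2 ^ b * R) + 1 := by
        rw [Int.card_Icc]
        have : ((2 ^ b * R : ℤ) + 1 - -(2 ^ b * R : ℤ)) = ((2 * (2 ^ b * R) + 1 : ℕ) : ℤ) := by
          push_cast; ring
        rw [this, Int.toNat_natCast]
    _ ≤ (2 * R + 1) * 2 ^ b := by
        have : 1 ≤ 2 ^ b := Nat.one_le_two_pow
        nlinarith

lemma finite_feasible {Ω : Type*} [MeasurableSpace Ω] (μ : Measure Ω) (X : ℕ → Ω → ℝ) {𝒳 : Set ℝ}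
    {b : ℕ} (h : (quantizedAlphabet 𝒳 b).Finite) (k n : ℕ) (γ : ℝ) :
    (feasible μ X 𝒳 b k n γ).Finite := by
  have h1 : (Set.univ.pi fun _ : Fin n => quantizedAlphabet 𝒳 b).Finite := Set.Finite.pi fun _ => h
  refine (h1.image (WithLp.toLp 2)).subset fun u hu => ⟨u.ofLp, fun i _ => hu.1 i, rfl⟩

/-! ### Projected gradient descent: existence and one-step contraction -/

/-- Projected gradient descent can be run on every nonempty finite set. -/
lemma exists_isPGDRun {m n : ℕ} {F : Set (EuclideanSpace ℝ (Fin n))} (hfin : F.Finite)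
    (hne : F.Nonempty) (A : Matrix (Fin m) (Fin n) ℝ) (y : Fin m → ℝ) (η : ℝ) :
    ∃ x, IsPGDRun F A y η x := by
  have h : ∀ s : EuclideanSpace ℝ (Fin n), ∃ v ∈ F, ∀ u ∈ F, ‖v - s‖ ≤ ‖u - s‖ := fun s =>
    Set.exists_min_image F (fun u => ‖u - s‖) hfin hne
  choose p hp1 hp2 using h
  let x : ℕ → EuclideanSpace ℝ (Fin n) := fun t => (fun v => p (gradStep A y η v))^[t] 0
  have hx : ∀ t, x (t + 1) = p (gradStep A y η (x t)) := fun t =>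
    Function.iterate_succ_apply' _ _ _
  exact ⟨x, rfl, fun t => hx t ▸ hp1 _, fun t => hx t ▸ hp2 _⟩

/-- The scaled Gram matrix minus the identity, as an operator. -/
noncomputable def gramDefect {m n : ℕ} (A : Matrix (Fin m) (Fin n) ℝ) (η : ℝ) :
    EuclideanSpace ℝ (Fin n) →L[ℝ] EuclideanSpace ℝ (Fin n) :=
  η • Matrix.toEuclideanCLM (𝕜 := ℝ) (Aᵀ * A) - 1

lemma gramDefect_apply {m n : ℕ} (A : Matrix (Fin m) (Fin n) ℝ) (η : ℝ)
    (u : EuclideanSpace ℝ (Fin n)) :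
    gramDefect A η u = η • WithLp.toLp 2 (Aᵀ *ᵥ (A *ᵥ u.ofLp)) - u := by
  unfold gramDefect
  simp only [Matrix.mulVec_mulVec]
  rfl

/-- Write `η AᵀA = 1 + D` with `D` the Gram defect. The step from `x` lands at `x₀ + D (x₀ - x) + η
Aᵀ z`, so the old error survives only through `D`. Splitting `x₀ - x` at `q` separates it from the
quantization error `x₀ - q`. -/
lemma gradStep_sub {m n : ℕ} (A : Matrix (Fin m) (Fin n) ℝ) (z : Fin m → ℝ) (η : ℝ)
    (x x₀ q : EuclideanSpace ℝ (Fin n)) :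
    gradStep A (A *ᵥ x₀.ofLp + z) η x - q =
      -gramDefect A η (x - q) + gramDefect A η (x₀ - q) + (x₀ - q)
        + η • WithLp.toLp 2 (Aᵀ *ᵥ z) := by
  have h : gradStep A (A *ᵥ x₀.ofLp + z) η x = x + η • WithLp.toLp 2 (Aᵀ *ᵥ (A *ᵥ (x₀ - x).ofLp))
      + η • WithLp.toLp 2 (Aᵀ *ᵥ z) := by
    have e : A *ᵥ x₀.ofLp + z - A *ᵥ x.ofLp = A *ᵥ (x₀ - x).ofLp + z := by
      rw [WithLp.ofLp_sub, Matrix.mulVec_sub]; abel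
    unfold gradStep
    rw [e, Matrix.mulVec_add, WithLp.toLp_add, smul_add, add_assoc]
  have h2 : gramDefect A η (x₀ - x) = gramDefect A η (x₀ - q) - gramDefect A η (x - q) := by
    rw [← map_sub]; congr 1; abel
  rw [gramDefect_apply] at h2
  rw [h, eq_add_of_sub_eq h2]
  abel

/-- One step of projected gradient descent contracts the error. -/
lemma IsPGDRun.norm_sub_le {m n : ℕ} {F : Set (EuclideanSpace ℝ (Fin n))}
    {A : Matrix (Fin m) (Fin n) ℝ} {z : Fin m → ℝ} {η τ : ℝ} (hη : 0 ≤ η)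
    {x : ℕ → EuclideanSpace ℝ (Fin n)} {x₀ q : EuclideanSpace ℝ (Fin n)} (hq : q ∈ F)
    (hA : ‖gramDefect A η‖ ≤ τ) (hx : IsPGDRun F A (A *ᵥ x₀.ofLp + z) η x) (t : ℕ) :
    ‖x (t + 1) - q‖ ≤
      2 * (τ * ‖x t - q‖ + (1 + τ) * ‖x₀ - q‖ + η * ‖WithLp.toLp 2 (Aᵀ *ᵥ z)‖) := by
  set s := gradStep A (A *ᵥ x₀.ofLp + z) η (x t) with hs
  -- Since `q` competes in the minimization, the projected point is at most as far from `s` as `q`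
  -- is; the triangle inequality then costs a factor 2.
  have h1 : ‖x (t + 1) - q‖ ≤ 2 * ‖s - q‖ := by
    calc ‖x (t + 1) - q‖ ≤ ‖x (t + 1) - s‖ + ‖s - q‖ := norm_sub_le_norm_sub_add_norm_sub _ _ _
      _ ≤ ‖q - s‖ + ‖s - q‖ := by gcongr; exact hx.nearest t q hq
      _ = 2 * ‖s - q‖ := by rw [norm_sub_rev q s]; ring
  have h2 : ‖s - q‖ ≤ τ * ‖x t - q‖ + (1 + τ) * ‖x₀ - q‖ + η * ‖WithLp.toLp 2 (Aᵀ *ᵥ z)‖ := by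
    rw [hs, gradStep_sub]
    have e1 : ‖gramDefect A η (x t - q)‖ ≤ τ * ‖x t - q‖ := ContinuousLinearMap.le_of_opNorm_le _ hA _
    have e2 : ‖gramDefect A η (x₀ - q)‖ ≤ τ * ‖x₀ - q‖ := ContinuousLinearMap.le_of_opNorm_le _ hA _
    refine (norm_add_le _ _).trans ?_
    have e3 : ‖-gramDefect A η (x t - q) + gramDefect A η (x₀ - q) + (x₀ - q)‖ ≤
        τ * ‖x t - q‖ + (1 + τ) * ‖x₀ - q‖ := by
      refine (norm_add_le _ _).trans ?_
      have := norm_add_le (-gramDefect A η (x t - q)) (gramDefect A η (x₀ - q))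
      rw [norm_neg] at this
      linarith
    rw [norm_smul, Real.norm_eq_abs, abs_of_nonneg hη]
    linarith
  linarith

end QMAP

namespace QMAP

/-! ### Nets on the unit sphere -/

section Net

variable {E : Type*} [NormedAddCommGroup E] [NormedSpace ℝ E] [FiniteDimensional ℝ E]

open Module Metric

open scoped Function in
/-- A `1/4`-separated set in the unit ball has at most `9 ^ dim` elements. -/
lemma card_le_of_quarter_separated (s : Finset E) (hs : ∀ c ∈ s, ‖c‖ ≤ 1)
    (h : ∀ c ∈ s, ∀ d ∈ s, c ≠ d → 1 / 4 ≤ ‖c - d‖) : s.card ≤ 9 ^ finrank ℝ E := by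
  borelize E
  let μ : Measure E := Measure.addHaar
  have D : Set.Pairwise (s : Set E) (Disjoint on fun c => ball (c : E) (1 / 8)) := by
    intro c hc d hd hcd
    apply ball_disjoint_ball
    rw [dist_eq_norm]
    linarith [h c hc d hd hcd]
  -- Disjoint balls of radius `1/8` packed in a ball of radius `9/8`: the ratio of volumes is `9 ^
  -- dim`.
  have hsub : (⋃ c ∈ s, ball (c : E) (1 / 8)) ⊆ ball (0 : E) (9 / 8) := by
    refine Set.iUnion₂_subset fun x hx => ball_subset_ball' ?_
    rw [dist_zero_right]
    linarith [hs x hx]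
  have I : (s.card : ℝ≥0∞) * ENNReal.ofReal ((1 / 8) ^ finrank ℝ E) * μ (ball 0 1) ≤
      ENNReal.ofReal ((9 / 8) ^ finrank ℝ E) * μ (ball 0 1) :=
    calc
      _ = μ (⋃ c ∈ s, ball (c : E) (1 / 8)) := by
        rw [measure_biUnion_finset D fun c _ => measurableSet_ball]
        simp only [μ.addHaar_ball_of_pos _ (show (0 : ℝ) < 1 / 8 by norm_num), Finset.sum_const,
          nsmul_eq_mul, mul_assoc]
      _ ≤ μ (ball (0 : E) (9 / 8)) := measure_mono hsub
      _ = _ := by simp only [μ.addHaar_ball_of_pos _ (show (0 : ℝ) < 9 / 8 by norm_num)]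
  have J := (ENNReal.mul_le_mul_iff_left (measure_ball_pos μ (0 : E) zero_lt_one).ne'
    measure_ball_lt_top.ne).1 I
  have K : (s.card : ℝ) ≤ (9 : ℝ) ^ finrank ℝ E := by
    have := ENNReal.toReal_le_of_le_ofReal (by positivity) J
    simpa [div_eq_mul_inv, mul_pow] using this
  exact mod_cast K

/-- The unit sphere has a `1/4`-net with at most `9 ^ dim` elements. -/
lemma exists_quarter_net_sphere (E : Type*) [NormedAddCommGroup E] [NormedSpace ℝ E]
    [FiniteDimensional ℝ E] : ∃ s : Finset E, (∀ c ∈ s, ‖c‖ = 1) ∧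
      (∀ x : E, ‖x‖ = 1 → ∃ y ∈ s, ‖x - y‖ ≤ 1 / 4) ∧ s.card ≤ 9 ^ finrank ℝ E := by
  classical
  let P : Finset E → Prop := fun s =>
    (∀ c ∈ s, ‖c‖ = 1) ∧ ∀ c ∈ s, ∀ d ∈ s, c ≠ d → 1 / 4 ≤ ‖c - d‖
  have hP : ∀ s, P s → s.card ≤ 9 ^ finrank ℝ E := fun s hs =>
    card_le_of_quarter_separated s (fun c hc => (hs.1 c hc).le) hs.2
  let N : Set ℕ := {l | ∃ s, P s ∧ s.card = l}
  have hne : N.Nonempty := ⟨0, ∅, by simp [P], rfl⟩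
  have hbdd : BddAbove N := ⟨9 ^ finrank ℝ E, by rintro _ ⟨s, hs, rfl⟩; exact hP s hs⟩
  -- A separated set of maximal cardinality is a net: a point of the sphere far from it could be
  -- added.
  obtain ⟨s, hs, hcard⟩ := Nat.sSup_mem hne hbdd
  refine ⟨s, hs.1, fun x hx => ?_, hP s hs⟩
  by_contra! hfar
  have hxs : x ∉ s := fun hxs => by
    have := hfar x hxs
    rw [sub_self, norm_zero] at this
    linarith
  have hins : P (insert x s) := by
    refine ⟨fun c hc => ?_, fun c hc d hd hcd => ?_⟩
    · rcases Finset.mem_insert.1 hc with rfl | hc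
      exacts [hx, hs.1 c hc]
    · rcases Finset.mem_insert.1 hc with hc' | hc' <;>
        rcases Finset.mem_insert.1 hd with hd' | hd'
      · exact absurd (hc'.trans hd'.symm) hcd
      · rw [hc']; exact (hfar d hd').le
      · rw [hd', norm_sub_rev]; exact (hfar c hc').le
      · exact hs.2 c hc' d hd' hcd
  have := le_csSup hbdd ⟨insert x s, hins, rfl⟩
  rw [Finset.card_insert_of_notMem hxs, hcard] at this
  omega

end Net

/-! ### Operator norm from a quadratic form on a net -/

section Symmetric

variable {E : Type*} [NormedAddCommGroup E] [InnerProductSpace ℝ E]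

/-- The norm of a symmetric operator is controlled by its quadratic form on a `1/4`-net. -/
lemma norm_le_of_quarter_net (B : E →L[ℝ] E) (hB : ∀ u v, inner ℝ (B u) v = inner ℝ u (B v))
    {s : Finset E} (hs : ∀ c ∈ s, ‖c‖ = 1)
    (hnet : ∀ x : E, ‖x‖ = 1 → ∃ y ∈ s, ‖x - y‖ ≤ 1 / 4) {c : ℝ} (hc : 0 ≤ c)
    (h : ∀ y ∈ s, |inner ℝ (B y) y| ≤ c) : ‖B‖ ≤ 2 * c := by
  -- The bound on the whole sphere involves `‖B‖` itself; proving `‖B‖ ≤ c + ‖B‖ / 2` and absorbing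
  -- gives `2 * c`.
  set D := c + ‖B‖ / 2 with hD
  have hD0 : 0 ≤ D := by positivity
  have hunit : ∀ x : E, ‖x‖ = 1 → |inner ℝ (B x) x| ≤ D := by
    intro x hx
    obtain ⟨y, hy, hxy⟩ := hnet x hx
    have e : inner ℝ (B x) x = inner ℝ (B y) y + inner ℝ (B (x - y)) (x + y) := by
      rw [map_sub, inner_sub_left, inner_add_right, inner_add_right, hB y x,
        real_inner_comm (B x) y]
      ring
    have e2 : |inner ℝ (B (x - y)) (x + y)| ≤ ‖B‖ / 2 := by
      calc |inner ℝ (B (x - y)) (x + y)| ≤ ‖B (x - y)‖ * ‖x + y‖ := abs_real_inner_le_norm _ _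
        _ ≤ (‖B‖ * (1 / 4)) * 2 := by
          gcongr
          · exact B.le_opNorm_of_le hxy
          · refine (norm_add_le _ _).trans ?_
            rw [hx, hs y hy]; norm_num
        _ = ‖B‖ / 2 := by ring
    rw [e]
    exact (abs_add_le _ _).trans (add_le_add (h y hy) e2)
  have hquad : ∀ x : E, |inner ℝ (B x) x| ≤ D * ‖x‖ ^ 2 := by
    intro x
    rcases eq_or_ne x 0 with rfl | hx
    · simp
    have hx' : ‖x‖ ≠ 0 := norm_ne_zero_iff.2 hx
    have h1 := hunit (‖x‖⁻¹ • x) (by rw [norm_smul, norm_inv, norm_norm, inv_mul_cancel₀ hx'])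
    rw [map_smul, inner_smul_left, inner_smul_right] at h1
    simp only [conj_trivial] at h1
    rw [← mul_assoc, abs_mul, abs_of_nonneg (by positivity)] at h1
    calc |inner ℝ (B x) x| = (‖x‖⁻¹ * ‖x‖⁻¹ * |inner ℝ (B x) x|) * ‖x‖ ^ 2 := by field_simp
      _ ≤ D * ‖x‖ ^ 2 := by gcongr
  -- Polarization and the parallelogram law turn the quadratic bound into a bilinear one.
  have hpol : ∀ u v : E, inner ℝ (B u) v ≤ D / 2 * (‖u‖ ^ 2 + ‖v‖ ^ 2) := by
    intro u v
    have e : 4 * inner ℝ (B u) v = inner ℝ (B (u + v)) (u + v) - inner ℝ (B (u - v)) (u - v) := by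
      simp only [map_add, map_sub, inner_add_left, inner_add_right, inner_sub_left, inner_sub_right]
      rw [hB v u, real_inner_comm (B u) v]
      ring
    have h1 := le_of_abs_le (hquad (u + v))
    have h2 := neg_le_of_abs_le (hquad (u - v))
    have h3 := parallelogram_law_with_norm ℝ u v
    nlinarith
  have hfin : ‖B‖ ≤ D := by
    refine B.opNorm_le_bound hD0 fun u => ?_
    rcases eq_or_ne (B u) 0 with h0 | h0
    · rw [h0, norm_zero]; positivity
    have hBu : ‖B u‖ ≠ 0 := norm_ne_zero_iff.2 h0
    have hu : 0 < ‖u‖ := norm_pos_iff.2 fun h => h0 (by rw [h, map_zero])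
    -- The test vector is parallel to `B u` and has the norm of `u`, which makes the bilinear bound
    -- sharp.
    have h1 := hpol u ((‖u‖ / ‖B u‖) • B u)
    rw [inner_smul_right, real_inner_self_eq_norm_sq, norm_smul, Real.norm_eq_abs,
      abs_of_nonneg (by positivity), div_mul_cancel₀ _ hBu] at h1
    have h2 : ‖u‖ / ‖B u‖ * ‖B u‖ ^ 2 = ‖u‖ * ‖B u‖ := by field_simp
    rw [h2] at h1
    nlinarith
  linarith

end Symmetric

/-! ### Chi-square concentration -/

section ChiSquare

lemma gaussianPDFReal_mul_exp_sq {v : ℝ≥0} (hv : v ≠ 0) (s x : ℝ) :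
    gaussianPDFReal 0 v x * Real.exp (s * x ^ 2) =
      (√(2 * Real.pi * v))⁻¹ * Real.exp (-((1 - 2 * s * v) / (2 * v)) * x ^ 2) := by
  have hv' : (v : ℝ) ≠ 0 := by exact_mod_cast hv
  rw [gaussianPDFReal, mul_assoc, ← Real.exp_add]
  congr 2
  field_simp
  ring

lemma integrable_exp_mul_sq_gaussianReal {v : ℝ≥0} (hv : v ≠ 0) {s : ℝ} (hs : 2 * s * v < 1) :
    Integrable (fun x => Real.exp (s * x ^ 2)) (gaussianReal 0 v) := by
  have hv' : (0 : ℝ) < v := by positivity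
  rw [gaussianReal_of_var_ne_zero _ hv, integrable_withDensity_iff_integrable_smul₀'
    (measurable_gaussianPDF 0 v).aemeasurable (ae_of_all _ fun x => gaussianPDF_lt_top)]
  simp_rw [toReal_gaussianPDF, smul_eq_mul, gaussianPDFReal_mul_exp_sq hv]
  exact (integrable_exp_neg_mul_sq (div_pos (by linarith) (by positivity))).const_mul _

lemma integral_exp_mul_sq_gaussianReal {v : ℝ≥0} (hv : v ≠ 0) {s : ℝ} (hs : 2 * s * v < 1) :
    ∫ x, Real.exp (s * x ^ 2) ∂gaussianReal 0 v = (√(1 - 2 * s * v))⁻¹ := by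
  have hv' : (0 : ℝ) < v := by positivity
  have hs' : 0 < 1 - 2 * s * v := by linarith
  rw [integral_gaussianReal_eq_integral_smul hv]
  simp_rw [smul_eq_mul, gaussianPDFReal_mul_exp_sq hv]
  rw [integral_const_mul, integral_gaussian, ← Real.sqrt_inv, ← Real.sqrt_inv,
    ← Real.sqrt_mul (by positivity)]
  congr 1
  have := Real.pi_pos
  field_simp

variable {Ω : Type*} [MeasurableSpace Ω] {μ : Measure Ω}

lemma mgf_sq_of_gaussian {W : Ω → ℝ} (hW : AEMeasurable W μ) {v : ℝ≥0} (hv : v ≠ 0)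
    (hlaw : μ.map W = gaussianReal 0 v) {s : ℝ} (hs : 2 * s * v < 1) :
    Integrable (fun ω => Real.exp (s * W ω ^ 2)) μ ∧
      mgf (fun ω => W ω ^ 2) μ s = (√(1 - 2 * s * v))⁻¹ := by
  have hm : AEStronglyMeasurable (fun x : ℝ => Real.exp (s * x ^ 2)) (μ.map W) := by fun_prop
  constructor
  · have := integrable_exp_mul_sq_gaussianReal hv hs
    rw [← hlaw] at this
    exact (integrable_map_measure hm hW).1 this
  · rw [← integral_exp_mul_sq_gaussianReal hv hs, ← hlaw, integral_map hW hm]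
    rfl

lemma mgf_sum_sq_of_gaussian [IsProbabilityMeasure μ] {m : ℕ} {W : Fin m → Ω → ℝ}
    (hW : ∀ j, Measurable (W j))
    {v : ℝ≥0} (hv : v ≠ 0) (hlaw : ∀ j, μ.map (W j) = gaussianReal 0 v) (hind : iIndepFun W μ)
    {s : ℝ} (hs : 2 * s * v < 1) :
    Integrable (fun ω => Real.exp (s * ∑ j, W j ω ^ 2)) μ ∧
      mgf (fun ω => ∑ j, W j ω ^ 2) μ s = (√(1 - 2 * s * v))⁻¹ ^ m := by
  have hind2 : iIndepFun (fun j ω => W j ω ^ 2) μ :=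
    hind.comp (fun _ x => x ^ 2) fun _ => by fun_prop
  have hm : ∀ j, Measurable fun ω => W j ω ^ 2 := fun j => (hW j).pow_const 2
  have e : (fun ω => ∑ j, W j ω ^ 2) = ∑ j, fun ω => W j ω ^ 2 := by
    ext ω; simp
  constructor
  · have := hind2.integrable_exp_mul_sum hm (t := s) (s := Finset.univ)
      fun j _ => (mgf_sq_of_gaussian (hW j).aemeasurable hv (hlaw j) hs).1
    simpa [Finset.sum_apply] using this
  · rw [e, hind2.mgf_sum hm]
    simp_rw [fun j => (mgf_sq_of_gaussian (hW j).aemeasurable hv (hlaw j) hs).2]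
    simp

/-- Concentration of a sum of squares of independent centred Gaussian variables. -/
lemma measure_sum_sq_gaussian_le [IsProbabilityMeasure μ] {m : ℕ} {W : Fin m → Ω → ℝ}
    (hW : ∀ j, Measurable (W j))
    {v : ℝ≥0} (hv : v ≠ 0) (hlaw : ∀ j, μ.map (W j) = gaussianReal 0 v) (hind : iIndepFun W μ) :
    μ.real {ω | 6 / 5 * (m * v) ≤ ∑ j, W j ω ^ 2} ≤ (199 / 200) ^ m ∧
      μ.real {ω | ∑ j, W j ω ^ 2 ≤ 4 / 5 * (m * v)} ≤ (199 / 200) ^ m := by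
  have hv' : (0 : ℝ) < v := by positivity
  constructor
  -- Chernoff bound with parameter `1/(10 v)`: each square contributes the factor `e^{-3/25} /
  -- √(4/5)`, which is at most `199/200`.
  · have h2 : 2 * (1 / (10 * v)) * (v : ℝ) = 1 / 5 := by field_simp; norm_num
    obtain ⟨hi, hmgf⟩ := mgf_sum_sq_of_gaussian hW hv hlaw hind
      (s := 1 / (10 * v)) (by rw [h2]; norm_num)
    refine (measure_ge_le_exp_mul_mgf (6 / 5 * (m * v)) (by positivity) hi).trans ?_
    rw [hmgf, h2]
    have e : -(1 / (10 * (v : ℝ))) * (6 / 5 * (m * v)) = m * (-(3 / 25)) := by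
      field_simp; ring
    rw [e, Real.exp_nat_mul, ← mul_pow]
    refine pow_le_pow_left₀ (by positivity) ?_ m
    rw [← div_eq_mul_inv, div_le_iff₀ (Real.sqrt_pos.2 (by norm_num)), Real.exp_neg,
      inv_le_iff_one_le_mul₀ (Real.exp_pos _)]
    have h1 := Real.quadratic_le_exp_of_nonneg (show (0 : ℝ) ≤ 3 / 25 by norm_num)
    have h3 : (894 / 1000 : ℝ) ≤ √(1 - 1 / 5) := Real.le_sqrt_of_sq_le (by norm_num)
    calc (1 : ℝ) ≤ 199 / 200 * (894 / 1000) * (1 + 3 / 25 + (3 / 25) ^ 2 / 2) := by norm_num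
      _ ≤ _ := by gcongr
  -- The lower tail uses the opposite parameter; the factor is now `e^{2/25} / √(6/5)`.
  · have h2 : 2 * (-(1 / (10 * v))) * (v : ℝ) = -(1 / 5) := by field_simp; norm_num
    obtain ⟨hi, hmgf⟩ := mgf_sum_sq_of_gaussian hW hv hlaw hind
      (s := -(1 / (10 * v))) (by rw [h2]; norm_num)
    refine (measure_le_le_exp_mul_mgf (4 / 5 * (m * v))
      (neg_nonpos.2 (by positivity)) hi).trans ?_
    rw [hmgf, h2]
    have e : -(-(1 / (10 * (v : ℝ)))) * (4 / 5 * (m * v)) = m * (2 / 25) := by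
      field_simp; ring
    rw [e, Real.exp_nat_mul, ← mul_pow]
    refine pow_le_pow_left₀ (by positivity) ?_ m
    rw [← div_eq_mul_inv, div_le_iff₀ (Real.sqrt_pos.2 (by norm_num))]
    have h1 : Real.exp (2 / 25) ≤ 25 / 23 := by
      have := Real.add_one_le_exp (-(2 / 25 : ℝ))
      rw [Real.exp_neg] at this
      have hp := Real.exp_pos (2 / 25)
      rw [le_inv_comm₀ (by norm_num) hp] at this
      refine this.trans (by norm_num)
    have h3 : (1095 / 1000 : ℝ) ≤ √(1 - -(1 / 5)) := Real.le_sqrt_of_sq_le (by norm_num)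
    linarith

end ChiSquare

end QMAP

namespace QMAP

/-! ### Gaussian matrices: near isometry -/

variable {Ω : Type*} [MeasurableSpace Ω] {μ : Measure Ω}

section GaussianMoments

variable {W : Ω → ℝ} {v : ℝ≥0}

lemma hasGaussianLaw_of_map_eq (hlaw : μ.map W = gaussianReal 0 v) : HasGaussianLaw W μ :=
  ⟨by rw [hlaw]; infer_instance⟩

lemma memLp_two_of_map_eq_gaussianReal (hlaw : μ.map W = gaussianReal 0 v) : MemLp W 2 μ :=
  (hasGaussianLaw_of_map_eq hlaw).memLp_two

lemma integral_of_map_eq_gaussianReal (hW : Measurable W) (hlaw : μ.map W = gaussianReal 0 v) :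
    ∫ ω, W ω ∂μ = 0 := by
  rw [← integral_id_gaussianReal (μ := 0) (v := v), ← hlaw, integral_map hW.aemeasurable
    (by fun_prop)]

lemma variance_of_map_eq_gaussianReal (hW : Measurable W) (hlaw : μ.map W = gaussianReal 0 v) :
    Var[W; μ] = v := by
  rw [← variance_id_gaussianReal (μ := 0) (v := v), ← hlaw, variance_map (by fun_prop)
    hW.aemeasurable]
  rfl

lemma integral_sq_of_map_eq_gaussianReal [IsProbabilityMeasure μ] (hW : Measurable W)
    (hlaw : μ.map W = gaussianReal 0 v) : ∫ ω, W ω * W ω ∂μ = v := by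
  rw [← variance_of_map_eq_gaussianReal hW hlaw,
    variance_of_integral_eq_zero hW.aemeasurable (integral_of_map_eq_gaussianReal hW hlaw)]
  simp_rw [pow_two]

end GaussianMoments

variable [IsProbabilityMeasure μ] {m n : ℕ} {A : Ω → Matrix (Fin m) (Fin n) ℝ} {v : ℝ≥0}

/-- The product of an i.i.d. Gaussian matrix with a fixed vector is an i.i.d. Gaussian vector. -/
lemma gaussian_mulVec (hAmeas : ∀ i j, Measurable fun ω => A ω i j)
    (hAlaw : ∀ i j, μ.map (fun ω => A ω i j) = gaussianReal 0 v)
    (hAindep : iIndepFun (fun (p : Fin m × Fin n) ω => A ω p.1 p.2) μ)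
    (y : EuclideanSpace ℝ (Fin n)) (hy : ‖y‖ = 1) :
    (∀ j, μ.map (fun ω => (A ω *ᵥ y.ofLp) j) = gaussianReal 0 v) ∧
      iIndepFun (fun j ω => (A ω *ᵥ y.ofLp) j) μ := by
  have hrow : ∀ j, (fun ω => (A ω *ᵥ y.ofLp) j) = fun ω => ∑ i, y i * A ω j i := by
    intro j; ext ω
    simp only [Matrix.mulVec, dotProduct]
    exact Finset.sum_congr rfl fun i _ => mul_comm _ _
  have hL2 : ∀ i j, MemLp (fun ω => A ω i j) 2 μ := fun i j =>
    memLp_two_of_map_eq_gaussianReal (hAlaw i j)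
  have hjoint : HasGaussianLaw (fun ω (p : Fin m × Fin n) => A ω p.1 p.2) μ :=
    hAindep.hasGaussianLaw fun p => hasGaussianLaw_of_map_eq (hAlaw p.1 p.2)
  let L : ((Fin m × Fin n) → ℝ) →L[ℝ] (Fin m → ℝ) :=
    ContinuousLinearMap.pi fun j => ∑ i, y i • ContinuousLinearMap.proj (j, i)
  have hjoint2 : HasGaussianLaw (fun ω j => (A ω *ᵥ y.ofLp) j) μ := by
    have := hjoint.map_fun L
    have e : (fun ω j => (A ω *ᵥ y.ofLp) j) = fun ω => L fun p => A ω p.1 p.2 := by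
      funext ω j
      rw [congrFun (hrow j) ω]
      simp [L]
    rw [e]
    exact this
  have hcov : ∀ j j', cov[fun ω => (A ω *ᵥ y.ofLp) j, fun ω => (A ω *ᵥ y.ofLp) j'; μ] =
      ∑ i, ∑ i', y i * (y i' * cov[fun ω => A ω j i, fun ω => A ω j' i'; μ]) := by
    intro j j'
    rw [hrow j, hrow j', covariance_fun_sum_fun_sum (fun i => (hL2 j i).const_mul _)
      (fun i => (hL2 j' i).const_mul _)]
    simp_rw [covariance_const_mul_left, covariance_const_mul_right]
  have hcov0 : ∀ p q : Fin m × Fin n, p ≠ q →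
      cov[fun ω => A ω p.1 p.2, fun ω => A ω q.1 q.2; μ] = 0 := fun p q hpq =>
    (hAindep.indepFun hpq).covariance_eq_zero (hL2 _ _) (hL2 _ _)
  constructor
  · intro j
    have hg : HasGaussianLaw (fun ω => (A ω *ᵥ y.ofLp) j) μ := hjoint2.eval j
    rw [hg.map_eq_gaussianReal]
    have h1 : ∫ ω, (A ω *ᵥ y.ofLp) j ∂μ = 0 := by
      rw [hrow j, integral_finsetSum _ fun i _ => ((hL2 j i).integrable one_le_two).const_mul _]
      simp_rw [integral_const_mul, integral_of_map_eq_gaussianReal (hAmeas j _) (hAlaw j _)]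
      simp
    have h2 : Var[fun ω => (A ω *ᵥ y.ofLp) j; μ] = v := by
      rw [← covariance_self hg.aemeasurable, hcov]
      have : ∀ i, ∑ i', y i * (y i' * cov[fun ω => A ω j i, fun ω => A ω j i'; μ]) =
          y i ^ 2 * v := by
        intro i
        rw [Finset.sum_eq_single i]
        · rw [covariance_self (hAmeas j i).aemeasurable,
            variance_of_map_eq_gaussianReal (hAmeas j i) (hAlaw j i)]
          ring
        · intro i' _ hi'
          rw [hcov0 (j, i) (j, i') (by simpa using hi'.symm)]
          ring
        · simp
      simp_rw [this]
      rw [← Finset.sum_mul]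
      have hn := EuclideanSpace.real_norm_sq_eq y
      rw [hy] at hn
      rw [← hn]; ring
    rw [h1, h2, Real.toNNReal_coe]
  -- The coordinates are jointly Gaussian, so uncorrelated suffices; distinct rows share no entry of
  -- `A`.
  · refine hjoint2.iIndepFun_of_covariance_eq_zero fun j j' hjj => ?_
    rw [hcov]
    refine Finset.sum_eq_zero fun i _ => Finset.sum_eq_zero fun i' _ => ?_
    rw [hcov0 (j, i) (j', i') (by simp [hjj])]
    ring

lemma inner_gramDefect (B : Matrix (Fin m) (Fin n) ℝ) (η : ℝ) (x y : EuclideanSpace ℝ (Fin n)) :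
    inner ℝ (gramDefect B η x) y = η * ((B *ᵥ x.ofLp) ⬝ᵥ (B *ᵥ y.ofLp)) - inner ℝ x y := by
  rw [gramDefect_apply, inner_sub_left, inner_smul_left]
  congr 2
  rw [EuclideanSpace.inner_eq_star_dotProduct, star_trivial, Matrix.mulVec_transpose,
    dotProduct_comm, Matrix.dotProduct_mulVec]

/-- A scaled tall Gaussian matrix is nearly an isometry, except with exponentially small
probability. -/
lemma measure_gramDefect_gt_le (hm : 0 < m) (hn : 0 < n)
    (hAmeas : ∀ i j, Measurable fun ω => A ω i j)
    (hAlaw : ∀ i j, μ.map (fun ω => A ω i j) = gaussianReal 0 (n : ℝ≥0)⁻¹)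
    (hAindep : iIndepFun (fun (p : Fin m × Fin n) ω => A ω p.1 p.2) μ) :
    μ {ω | ¬ ‖gramDefect (A ω) ((n : ℝ) / m)‖ ≤ 2 / 5} ≤
      ENNReal.ofReal (9 ^ n * (2 * (199 / 200) ^ m)) := by
  obtain ⟨s, hs1, hs2, hs3⟩ := exists_quarter_net_sphere (EuclideanSpace ℝ (Fin n))
  rw [finrank_euclideanSpace_fin] at hs3
  have hv : ((n : ℝ≥0)⁻¹) ≠ 0 := inv_ne_zero (by exact_mod_cast hn.ne')
  have hm' : (0 : ℝ) < m := by exact_mod_cast hm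
  have hn' : (0 : ℝ) < n := by exact_mod_cast hn
  let G : EuclideanSpace ℝ (Fin n) → Set Ω := fun y =>
    {ω | 6 / 5 * (m * ((n : ℝ≥0)⁻¹ : ℝ≥0)) ≤ ∑ j, (A ω *ᵥ y.ofLp) j ^ 2} ∪
    {ω | ∑ j, (A ω *ᵥ y.ofLp) j ^ 2 ≤ 4 / 5 * (m * ((n : ℝ≥0)⁻¹ : ℝ≥0))}
  have hG : ∀ y ∈ s, μ (G y) ≤ ENNReal.ofReal (2 * (199 / 200) ^ m) := by
    intro y hy
    obtain ⟨h1, h2⟩ := gaussian_mulVec hAmeas hAlaw hAindep y (hs1 y hy)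
    have hmeas : ∀ j, Measurable fun ω => (A ω *ᵥ y.ofLp) j := fun j => by
      simp only [Matrix.mulVec, dotProduct]
      exact Finset.measurable_sum _ fun i _ => (hAmeas j i).mul_const _
    obtain ⟨h3, h4⟩ := measure_sum_sq_gaussian_le hmeas hv h1 h2
    rw [← ofReal_measureReal]
    refine ENNReal.ofReal_le_ofReal ((measureReal_union_le _ _).trans ?_)
    linarith
  have hsub : {ω | ¬ ‖gramDefect (A ω) ((n : ℝ) / m)‖ ≤ 2 / 5} ⊆ ⋃ y ∈ s, G y := by
    intro ω hω
    by_contra hnot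
    simp only [Set.mem_iUnion, G, Set.mem_union, Set.mem_ofPred_eq, not_exists, not_or, not_le,
      NNReal.coe_inv, NNReal.coe_natCast] at hnot
    refine hω ?_
    -- Off the bad events the quadratic form is at most `1/5` in absolute value on the net; the
    -- passage to the operator norm doubles this to `2/5`.
    have := norm_le_of_quarter_net (gramDefect (A ω) ((n : ℝ) / m)) (fun u w => ?_) hs1 hs2
      (show (0 : ℝ) ≤ 1 / 5 by norm_num) fun y hy => ?_
    · linarith
    · rw [inner_gramDefect, real_inner_comm (gramDefect _ _ w) u, inner_gramDefect,
        dotProduct_comm, real_inner_comm u w]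
    · rw [inner_gramDefect, real_inner_self_eq_norm_sq, hs1 y hy]
      obtain ⟨h1, h2⟩ := hnot y hy
      have e : (A ω *ᵥ y.ofLp) ⬝ᵥ (A ω *ᵥ y.ofLp) = ∑ j, (A ω *ᵥ y.ofLp) j ^ 2 := by
        simp only [dotProduct, pow_two]
      rw [e]
      set T := ∑ j, (A ω *ᵥ y.ofLp) j ^ 2
      have h3 : (n : ℝ) / m * T ≤ 6 / 5 := by
        calc (n : ℝ) / m * T ≤ n / m * (6 / 5 * (m * (n : ℝ)⁻¹)) := by gcongr
          _ = 6 / 5 := by field_simp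
      have h4 : 4 / 5 ≤ (n : ℝ) / m * T := by
        calc (4 / 5 : ℝ) = n / m * (4 / 5 * (m * (n : ℝ)⁻¹)) := by field_simp
          _ ≤ (n : ℝ) / m * T := by gcongr
      rw [abs_le]
      constructor <;> linarith
  calc μ {ω | ¬ ‖gramDefect (A ω) ((n : ℝ) / m)‖ ≤ 2 / 5} ≤ μ (⋃ y ∈ s, G y) := measure_mono hsub
    _ ≤ ∑ y ∈ s, μ (G y) := measure_biUnion_finset_le _ _
    _ ≤ ∑ y ∈ s, ENNReal.ofReal (2 * (199 / 200) ^ m) := Finset.sum_le_sum hG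
    _ = s.card * ENNReal.ofReal (2 * (199 / 200) ^ m) := by
      rw [Finset.sum_const, nsmul_eq_mul]
    _ ≤ ENNReal.ofReal (9 ^ n) * ENNReal.ofReal (2 * (199 / 200) ^ m) := by
      gcongr
      rw [← ENNReal.ofReal_natCast]
      exact ENNReal.ofReal_le_ofReal (by exact_mod_cast hs3)
    _ = _ := (ENNReal.ofReal_mul (by positivity)).symm

/-! ### Back-projected noise -/

section Noise

variable {Z : Ω → Fin m → ℝ} {σ : ℝ≥0}

/-- After expanding the square, independence of `A` and `Z` factors each term. The terms with two
different noise coordinates vanish, and the remaining `n m` terms equal `σ² / n`. -/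
lemma integral_norm_sq_transpose_mulVec (hn : 0 < n)
    (hAmeas : ∀ i j, Measurable fun ω => A ω i j)
    (hAlaw : ∀ i j, μ.map (fun ω => A ω i j) = gaussianReal 0 (n : ℝ≥0)⁻¹)
    (hZmeas : ∀ i, Measurable fun ω => Z ω i)
    (hZlaw : ∀ i, μ.map (fun ω => Z ω i) = gaussianReal 0 (σ ^ 2))
    (hZindep : iIndepFun (fun (i : Fin m) ω => Z ω i) μ)
    (hAZ : IndepFun (fun ω (p : Fin m × Fin n) => A ω p.1 p.2) Z μ) :
    Integrable (fun ω => ‖WithLp.toLp 2 ((A ω)ᵀ *ᵥ Z ω)‖ ^ 2) μ ∧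
      ∫ ω, ‖WithLp.toLp 2 ((A ω)ᵀ *ᵥ Z ω)‖ ^ 2 ∂μ = m * σ ^ 2 := by
  have hAL : ∀ i j, MemLp (fun ω => A ω i j) 2 μ := fun i j =>
    memLp_two_of_map_eq_gaussianReal (hAlaw i j)
  have hZL : ∀ i, MemLp (fun ω => Z ω i) 2 μ := fun i =>
    memLp_two_of_map_eq_gaussianReal (hZlaw i)
  have hAA : ∀ i j j', Integrable (fun ω => A ω j i * A ω j' i) μ := fun i j j' =>
    (hAL j i).integrable_mul (hAL j' i)
  have hZZ : ∀ j j', Integrable (fun ω => Z ω j * Z ω j') μ := fun j j' =>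
    (hZL j).integrable_mul (hZL j')
  have hind : ∀ i j j', IndepFun (fun ω => A ω j i * A ω j' i) (fun ω => Z ω j * Z ω j') μ := by
    intro i j j'
    exact hAZ.comp (φ := fun a : Fin m × Fin n → ℝ => a (j, i) * a (j', i))
      (ψ := fun z : Fin m → ℝ => z j * z j') (by fun_prop) (by fun_prop)
  have hint : ∀ i j j', Integrable (fun ω => A ω j i * A ω j' i * (Z ω j * Z ω j')) μ :=
    fun i j j' => (hind i j j').integrable_mul (hAA i j j') (hZZ j j')
  have hval : ∀ i j j', ∫ ω, A ω j i * A ω j' i * (Z ω j * Z ω j') ∂μ =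
      if j = j' then (n : ℝ)⁻¹ * σ ^ 2 else 0 := by
    intro i j j'
    rw [(hind i j j').integral_fun_mul_eq_mul_integral (hAA i j j').1 (hZZ j j').1]
    split_ifs with h
    · subst h
      rw [integral_sq_of_map_eq_gaussianReal (hAmeas j i) (hAlaw j i),
        integral_sq_of_map_eq_gaussianReal (hZmeas j) (hZlaw j)]
      simp
    · rw [(hZindep.indepFun h).integral_fun_mul_eq_mul_integral (hZL j).1 (hZL j').1,
        integral_of_map_eq_gaussianReal (hZmeas j) (hZlaw j)]
      simp
  have hexp : (fun ω => ‖WithLp.toLp 2 ((A ω)ᵀ *ᵥ Z ω)‖ ^ 2) =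
      fun ω => ∑ i, ∑ j, ∑ j', A ω j i * A ω j' i * (Z ω j * Z ω j') := by
    ext ω
    rw [EuclideanSpace.real_norm_sq_eq]
    refine Finset.sum_congr rfl fun i _ => ?_
    simp only [Matrix.mulVec, dotProduct, Matrix.transpose_apply]
    rw [pow_two, Finset.sum_mul_sum]
    refine Finset.sum_congr rfl fun j _ => Finset.sum_congr rfl fun j' _ => ?_
    ring
  rw [hexp]
  constructor
  · exact integrable_finsetSum _ fun i _ => integrable_finsetSum _ fun j _ =>
      integrable_finsetSum _ fun j' _ => hint i j j'
  · rw [integral_finsetSum _ fun i _ => integrable_finsetSum _ fun j _ =>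
      integrable_finsetSum _ fun j' _ => hint i j j']
    simp_rw [integral_finsetSum _ fun j (_ : j ∈ Finset.univ) =>
      integrable_finsetSum _ fun j' (_ : j' ∈ Finset.univ) => hint _ j j',
      integral_finsetSum _ fun j' (_ : j' ∈ Finset.univ) => hint _ _ j', hval]
    have hn' : (n : ℝ) ≠ 0 := by exact_mod_cast hn.ne'
    simp
    field_simp

/-- Markov's inequality for the squared norm. With the threshold proportional to `σ`, the failure
bound does not depend on `σ`. -/
lemma measure_transpose_mulVec_noise_le (hn : 0 < n)
    (hAmeas : ∀ i j, Measurable fun ω => A ω i j)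
    (hAlaw : ∀ i j, μ.map (fun ω => A ω i j) = gaussianReal 0 (n : ℝ≥0)⁻¹)
    (hZmeas : ∀ i, Measurable fun ω => Z ω i)
    (hZlaw : ∀ i, μ.map (fun ω => Z ω i) = gaussianReal 0 (σ ^ 2))
    (hZindep : iIndepFun (fun (i : Fin m) ω => Z ω i) μ)
    (hAZ : IndepFun (fun ω (p : Fin m × Fin n) => A ω p.1 p.2) Z μ) {c : ℝ} (hc : 0 < c) :
    μ {ω | ¬ ‖WithLp.toLp 2 ((A ω)ᵀ *ᵥ Z ω)‖ ≤ σ * c} ≤ ENNReal.ofReal (m / c ^ 2) := by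
  obtain ⟨h1, h2⟩ :=
    integral_norm_sq_transpose_mulVec hn hAmeas hAlaw hZmeas hZlaw hZindep hAZ
  -- For `σ = 0` the threshold is zero and Markov's inequality is void; instead the second moment
  -- vanishes, so the vector is almost surely zero.
  rcases eq_or_ne σ 0 with rfl | hσ
  · have h3 : (fun ω => ‖WithLp.toLp 2 ((A ω)ᵀ *ᵥ Z ω)‖ ^ 2) =ᵐ[μ] 0 := by
      rw [← integral_eq_zero_iff_of_nonneg (fun ω => by positivity) h1, h2]
      simp
    have h4 : μ {ω | ¬ ‖WithLp.toLp 2 ((A ω)ᵀ *ᵥ Z ω)‖ ≤ ((0 : ℝ≥0) : ℝ) * c} = 0 := by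
      refine ae_iff.1 (h3.mono fun ω hω => ?_)
      have : ‖WithLp.toLp 2 ((A ω)ᵀ *ᵥ Z ω)‖ = 0 := by simpa using hω
      rw [this]; simp
    rw [h4]; exact zero_le
  · have hσ' : (0 : ℝ) < σ := by positivity
    have h3 := mul_meas_ge_le_integral_of_nonneg (ae_of_all μ fun ω => by positivity) h1
      ((σ * c) ^ 2)
    rw [h2] at h3
    calc μ {ω | ¬ ‖WithLp.toLp 2 ((A ω)ᵀ *ᵥ Z ω)‖ ≤ σ * c}
        ≤ μ {ω | (σ * c) ^ 2 ≤ ‖WithLp.toLp 2 ((A ω)ᵀ *ᵥ Z ω)‖ ^ 2} := by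
          refine measure_mono fun ω hω => ?_
          exact pow_le_pow_left₀ (by positivity) (not_le.1 hω).le 2
      _ = ENNReal.ofReal (μ.real {ω | (σ * c) ^ 2 ≤ ‖WithLp.toLp 2 ((A ω)ᵀ *ᵥ Z ω)‖ ^ 2}) :=
          (ofReal_measureReal).symm
      _ ≤ ENNReal.ofReal (m / c ^ 2) := by
          refine ENNReal.ofReal_le_ofReal ?_
          rw [le_div_iff₀ (by positivity)]
          have : 0 < (σ : ℝ) ^ 2 := by positivity
          simp_rw [mul_pow] at h3 ⊢
          rw [mul_assoc, mul_comm (m : ℝ), mul_le_mul_iff_right₀ this] at h3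
          linarith

end Noise

end QMAP

namespace QMAP

variable {Ω : Type*} [MeasurableSpace Ω] {μ : Measure Ω}

/-! ### A weak law under one-sided mixing -/

section FiniteProcess

variable [IsProbabilityMeasure μ] {α : Type*} [Fintype α] [MeasurableSpace α]
  [MeasurableSingletonClass α]

lemma integrable_comp_of_fintype {V : Ω → α} (hV : Measurable V) (φ : α → ℝ) :
    Integrable (fun ω => φ (V ω)) μ :=
  have := Measure.isProbabilityMeasure_map (μ := μ) hV.aemeasurable
  (Integrable.of_finite (μ := μ.map V) (f := φ)).comp_measurable hV

lemma integral_comp_of_fintype {V : Ω → α} (hV : Measurable V) (φ : α → ℝ) :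
    ∫ ω, φ (V ω) ∂μ = ∑ a, μ.real {ω | V ω = a} * φ a := by
  have := Measure.isProbabilityMeasure_map (μ := μ) hV.aemeasurable
  rw [← integral_map hV.aemeasurable (f := φ) Integrable.of_finite.1, integral_fintype
    Integrable.of_finite]
  refine Finset.sum_congr rfl fun a _ => ?_
  rw [map_measureReal_apply hV (measurableSet_singleton a), smul_eq_mul]
  rfl

variable {V : ℕ → Ω → α} {p : α → ℝ} {φ : α → ℝ} {ε : ℝ} {G : ℕ}

/-- Correlations of a nonnegative function of an upper mixing process. -/
lemma integral_centered_mul_le (hV : ∀ i, Measurable (V i))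
    (hp : ∀ i a, μ.real {ω | V i ω = a} = p a) (hφ : ∀ a, 0 ≤ φ a) (hε : 0 ≤ ε)
    (hmix : ∀ i j, i + G ≤ j → ∀ a c,
      μ.real {ω | V i ω = a ∧ V j ω = c} ≤ (1 + ε) * (p a * p c)) (i j : ℕ) :
    ∫ ω, (φ (V i ω) - ∑ a, p a * φ a) * (φ (V j ω) - ∑ a, p a * φ a) ∂μ ≤
      (if i < j + G ∧ j < i + G then ∑ a, p a * φ a ^ 2 else 0) + ε * ∑ a, p a * φ a ^ 2 := by
  have hE : ∀ (ψ : α → ℝ) i, ∫ ω, ψ (V i ω) ∂μ = ∑ a, p a * ψ a := fun ψ i => by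
    rw [integral_comp_of_fintype (hV i) ψ]
    simp_rw [hp]
  set M := ∑ a, p a * φ a with hM
  set K := ∑ a, p a * φ a ^ 2 with hK
  have hp0 : ∀ a, 0 ≤ p a := fun a => hp 0 a ▸ measureReal_nonneg
  have hK0 : 0 ≤ K := Finset.sum_nonneg fun a _ => mul_nonneg (hp0 a) (sq_nonneg _)
  have hpair : ∀ i j, Measurable fun ω => (V i ω, V j ω) := fun i j => (hV i).prodMk (hV j)
  have hint : ∀ i j, Integrable (fun ω => φ (V i ω) * φ (V j ω)) μ := fun i j =>
    integrable_comp_of_fintype (hpair i j) fun q => φ q.1 * φ q.2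
  have hsq : ∀ i, Integrable (fun ω => φ (V i ω) ^ 2) μ := fun i =>
    integrable_comp_of_fintype (hV i) fun q => φ q ^ 2
  have h1 : ∀ i, Integrable (fun ω => φ (V i ω)) μ := fun i => integrable_comp_of_fintype (hV i) φ
  -- The variance is nonnegative. This converts the excess `ε * M ^ 2` of distant correlations into
  -- `ε * K`.
  have hMK : M ^ 2 ≤ K := by
    have h := integral_nonneg (μ := μ) (f := fun ω => (φ (V 0 ω) - M) ^ 2) fun ω => sq_nonneg _
    have e : ∫ ω, (φ (V 0 ω) - M) ^ 2 ∂μ = K - M ^ 2 := by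
      rw [hE (fun a => (φ a - M) ^ 2) 0]
      have h2 : ∑ a, p a = 1 := by simpa using (hE (fun _ => 1) 0).symm
      have : ∀ a, p a * (φ a - M) ^ 2 = p a * φ a ^ 2 - 2 * M * (p a * φ a) + M ^ 2 * p a :=
        fun a => by ring
      simp_rw [this]
      rw [Finset.sum_add_distrib, Finset.sum_sub_distrib, ← Finset.mul_sum, ← Finset.mul_sum, h2,
        ← hM, ← hK]
      ring
    rw [e] at h
    linarith
  have hexp : ∀ i j, ∫ ω, (φ (V i ω) - M) * (φ (V j ω) - M) ∂μ =
      ∫ ω, φ (V i ω) * φ (V j ω) ∂μ - M ^ 2 := by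
    intro i j
    have e : ∀ ω, (φ (V i ω) - M) * (φ (V j ω) - M) =
        φ (V i ω) * φ (V j ω) - (M * φ (V i ω) + M * φ (V j ω) - M ^ 2) := fun ω => by ring
    simp_rw [e]
    have i1 : Integrable (fun ω => M * φ (V i ω) + M * φ (V j ω)) μ :=
      ((h1 i).const_mul M).add ((h1 j).const_mul M)
    have i2 : Integrable (fun ω => M * φ (V i ω) + M * φ (V j ω) - M ^ 2) μ :=
      i1.sub (integrable_const _)
    rw [integral_sub (hint i j) i2, integral_sub i1 (integrable_const _),
      integral_add ((h1 i).const_mul M) ((h1 j).const_mul M), integral_const_mul,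
      integral_const_mul, hE, hE, integral_const, probReal_univ, ← hM]
    simp only [smul_eq_mul]
    ring
  -- As `φ ≥ 0`, an upper bound on pair probabilities can be integrated against `φ a * φ c`; no
  -- lower mixing bound is needed.
  have hfar : ∀ i j, i + G ≤ j → ∫ ω, φ (V i ω) * φ (V j ω) ∂μ ≤ (1 + ε) * M ^ 2 := by
    intro i j hij
    rw [integral_comp_of_fintype (hpair i j) fun q => φ q.1 * φ q.2, Fintype.sum_prod_type, pow_two,
      hM, Finset.sum_mul_sum, Finset.mul_sum]
    refine Finset.sum_le_sum fun a _ => ?_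
    rw [Finset.mul_sum]
    refine Finset.sum_le_sum fun c _ => ?_
    have h2 : μ.real {ω | (V i ω, V j ω) = (a, c)} ≤ (1 + ε) * (p a * p c) := by
      simpa [Prod.ext_iff] using hmix i j hij a c
    calc _ ≤ (1 + ε) * (p a * p c) * (φ a * φ c) :=
          mul_le_mul_of_nonneg_right h2 (mul_nonneg (hφ a) (hφ c))
      _ = _ := by ring
  rw [hexp]
  split_ifs with h
  · have h2 : ∫ ω, φ (V i ω) * φ (V j ω) ∂μ ≤ ∫ ω, (φ (V i ω) ^ 2 + φ (V j ω) ^ 2) / 2 ∂μ :=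
      integral_mono (hint i j) (((hsq i).add (hsq j)).div_const 2) fun ω => by
        have := sq_nonneg (φ (V i ω) - φ (V j ω))
        simp only
        linarith
    rw [integral_div, integral_add (hsq i) (hsq j), hE (fun a => φ a ^ 2), hE (fun a => φ a ^ 2)]
      at h2
    have := mul_nonneg hε hK0
    nlinarith [sq_nonneg M]
  · have h3 : ∫ ω, φ (V i ω) * φ (V j ω) ∂μ ≤ (1 + ε) * M ^ 2 := by
      rcases le_or_gt (i + G) j with hij | hij
      · exact hfar i j hij
      · simp_rw [mul_comm (φ (V i _))]
        exact hfar j i (by omega)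
    nlinarith

/-- Chebyshev's inequality for the average of a nonnegative function of an upper mixing process. -/
lemma measure_sum_gt_le (hV : ∀ i, Measurable (V i))
    (hp : ∀ i a, μ.real {ω | V i ω = a} = p a) (hφ : ∀ a, 0 ≤ φ a) (hε : 0 ≤ ε)
    (hmix : ∀ i j, i + G ≤ j → ∀ a c,
      μ.real {ω | V i ω = a ∧ V j ω = c} ≤ (1 + ε) * (p a * p c)) {N : ℕ} (hN : 0 < N)
    {s : ℝ} (hs : 0 < s) :
    μ {ω | ¬ ∑ i ∈ Finset.range N, φ (V i ω) ≤ N * (∑ a, p a * φ a + s)} ≤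
      ENNReal.ofReal ((2 * G / N + ε) * (∑ a, p a * φ a ^ 2) / s ^ 2) := by
  have hcov := integral_centered_mul_le hV hp hφ hε hmix
  set M := ∑ a, p a * φ a with hM
  set K := ∑ a, p a * φ a ^ 2 with hK
  have hN' : (0 : ℝ) < N := by exact_mod_cast hN
  have hK0 : 0 ≤ K :=
    Finset.sum_nonneg fun a _ => mul_nonneg (hp 0 a ▸ measureReal_nonneg) (sq_nonneg _)
  have hint : ∀ i j, Integrable (fun ω => (φ (V i ω) - M) * (φ (V j ω) - M)) μ := fun i j =>
    integrable_comp_of_fintype ((hV i).prodMk (hV j)) fun q => (φ q.1 - M) * (φ q.2 - M)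
  set T : Ω → ℝ := fun ω => ∑ i ∈ Finset.range N, (φ (V i ω) - M) with hT
  have hT2 : ∀ ω, T ω ^ 2 =
      ∑ i ∈ Finset.range N, ∑ j ∈ Finset.range N, (φ (V i ω) - M) * (φ (V j ω) - M) := fun ω => by
    rw [hT, pow_two, Finset.sum_mul_sum]
  have hTint : Integrable (fun ω => T ω ^ 2) μ := by
    simp_rw [hT2]
    exact integrable_finsetSum _ fun i _ => integrable_finsetSum _ fun j _ => hint i j
  -- Each index has at most `2 * G` close neighbours, itself included; these pairs are bounded by
  -- `K` without any mixing.
  have hcount : ∀ i : ℕ, ((Finset.range N).filter fun j => i < j + G ∧ j < i + G).card ≤ 2 * G := by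
    intro i
    calc _ ≤ (Finset.Ico (i + 1 - G) (i + G)).card := by
          refine Finset.card_le_card fun j hj => ?_
          simp only [Finset.mem_filter, Finset.mem_Ico] at hj ⊢
          omega
      _ ≤ 2 * G := by rw [Nat.card_Ico]; omega
  have hvar : ∫ ω, T ω ^ 2 ∂μ ≤ N * (2 * G * K + N * (ε * K)) := by
    simp_rw [hT2]
    rw [integral_finsetSum _ fun i _ => integrable_finsetSum _ fun j _ => hint i j]
    simp_rw [integral_finsetSum _ fun j (_ : j ∈ Finset.range N) => hint _ j]
    calc _ ≤ ∑ i ∈ Finset.range N, ∑ j ∈ Finset.range N,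
          ((if i < j + G ∧ j < i + G then K else 0) + ε * K) :=
          Finset.sum_le_sum fun i _ => Finset.sum_le_sum fun j _ => hcov i j
      _ ≤ ∑ i ∈ Finset.range N, (2 * G * K + N * (ε * K)) := by
          refine Finset.sum_le_sum fun i _ => ?_
          rw [Finset.sum_add_distrib, ← Finset.sum_filter, Finset.sum_const, Finset.sum_const,
            Finset.card_range, nsmul_eq_mul, nsmul_eq_mul]
          have : (((Finset.range N).filter fun j => i < j + G ∧ j < i + G).card : ℝ) ≤ 2 * G := by
            exact_mod_cast hcount i
          gcongr
      _ = _ := by rw [Finset.sum_const, Finset.card_range, nsmul_eq_mul]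
  have hmarkov := mul_meas_ge_le_integral_of_nonneg (ae_of_all μ fun ω => sq_nonneg (T ω)) hTint
    ((N * s) ^ 2)
  calc μ {ω | ¬ ∑ i ∈ Finset.range N, φ (V i ω) ≤ N * (M + s)}
      ≤ μ {ω | (N * s) ^ 2 ≤ T ω ^ 2} := by
        refine measure_mono fun ω hω => ?_
        have h1 : N * (M + s) < ∑ i ∈ Finset.range N, φ (V i ω) := not_le.1 hω
        have h2 : T ω = ∑ i ∈ Finset.range N, φ (V i ω) - N * M := by
          rw [hT]
          simp only
          rw [Finset.sum_sub_distrib, Finset.sum_const, Finset.card_range, nsmul_eq_mul]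
        have h3 : N * s ≤ T ω := by rw [h2]; linarith
        exact pow_le_pow_left₀ (by positivity) h3 2
    _ = ENNReal.ofReal (μ.real {ω | (N * s) ^ 2 ≤ T ω ^ 2}) := (ofReal_measureReal).symm
    _ ≤ _ := by
        refine ENNReal.ofReal_le_ofReal ?_
        have h3 : μ.real {ω | (N * s) ^ 2 ≤ T ω ^ 2} ≤
            N * (2 * G * K + N * (ε * K)) / (N * s) ^ 2 := by
          rw [le_div_iff₀ (by positivity), mul_comm]
          exact hmarkov.trans hvar
        refine h3.trans (le_of_eq ?_)
        field_simp

end FiniteProcess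

/-! ### Second moment of the information content -/

section LogSq

/-- Split at `1 / p = N ^ 2`. For larger `p` the logarithm is at most `2 log N`. For smaller `p`,
`log (1/p) ≤ 4 p^{-1/4}` bounds the left side by `16 √p ≤ 16 / N`. Summed over an alphabet of size
`N`, the last term gives only a constant. -/
lemma mul_log_sq_le {p N : ℝ} (hp : 0 < p) (hp1 : p ≤ 1) (hN : 1 ≤ N) :
    p * Real.log (1 / p) ^ 2 ≤ 4 * Real.log N ^ 2 * p + 16 / N := by
  have hlog : 0 ≤ Real.log (1 / p) := Real.log_nonneg (by rw [le_div_iff₀ hp]; linarith)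
  rcases le_or_gt (1 / p) (N ^ 2) with h | h
  · have h1 : Real.log (1 / p) ≤ 2 * Real.log N := by
      have := Real.log_le_log (by positivity) h
      rwa [Real.log_pow, Nat.cast_ofNat] at this
    have h2 : Real.log (1 / p) ^ 2 ≤ (2 * Real.log N) ^ 2 := pow_le_pow_left₀ hlog h1 2
    have h3 : 0 ≤ 16 / N := by positivity
    nlinarith
  · set t := √(√p) with ht
    have ht0 : 0 < t := by positivity
    have ht2 : t ^ 2 = √p := Real.sq_sqrt (Real.sqrt_nonneg _)
    have ht4 : t ^ 4 = p := by
      rw [show t ^ 4 = (t ^ 2) ^ 2 by ring, ht2, Real.sq_sqrt hp.le]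
    have h1 : Real.log (1 / p) ≤ 4 * (1 / t) := by
      have e : 1 / p = (1 / t) ^ 4 := by rw [← ht4]; ring
      rw [e, Real.log_pow]
      have := Real.log_le_sub_one_of_pos (show 0 < 1 / t by positivity)
      push_cast
      linarith
    have h2 : p * Real.log (1 / p) ^ 2 ≤ 16 * √p := by
      calc p * Real.log (1 / p) ^ 2 ≤ p * (4 * (1 / t)) ^ 2 := by gcongr
        _ = 16 * √p := by rw [← ht2, ← ht4]; field_simp; ring
    have h3 : √p ≤ 1 / N := by
      rw [Real.sqrt_le_left (by positivity), div_pow, one_pow, le_div_iff₀ (by positivity)]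
      rw [lt_div_iff₀ hp] at h
      linarith
    have h4 : 0 ≤ 4 * Real.log N ^ 2 * p := by positivity
    calc _ ≤ 16 * √p := h2
      _ ≤ 16 * (1 / N) := by gcongr
      _ ≤ _ := by rw [mul_one_div]; linarith

/-- The second moment of the information content of a probability on a finite set. -/
lemma sum_mul_log_sq_le {α : Type*} [Fintype α] [Nonempty α] {p : α → ℝ} (hp0 : ∀ a, 0 ≤ p a)
    (hp1 : ∀ a, p a ≤ 1) (hp : ∑ a, p a = 1) :
    ∑ a, p a * Real.log (1 / p a) ^ 2 ≤ 4 * Real.log (Fintype.card α) ^ 2 + 16 := by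
  have hN : (1 : ℝ) ≤ Fintype.card α := by exact_mod_cast Fintype.card_pos
  calc ∑ a, p a * Real.log (1 / p a) ^ 2
      ≤ ∑ a, (4 * Real.log (Fintype.card α) ^ 2 * p a + 16 / Fintype.card α) := by
        refine Finset.sum_le_sum fun a _ => ?_
        rcases (hp0 a).eq_or_lt with h | h
        · rw [← h]; simp; positivity
        · exact mul_log_sq_le h (hp1 a) hN
    _ = _ := by
        rw [Finset.sum_add_distrib, ← Finset.mul_sum, hp, Finset.sum_const, Finset.card_univ,
          nsmul_eq_mul]
        field_simp

end LogSq

end QMAP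

namespace QMAP

set_option linter.unusedSectionVars false

/-! ### Windows of the quantized process -/

variable {Ω : Type*} [MeasurableSpace Ω] {μ : Measure Ω} {X : ℕ → Ω → ℝ} {𝒳 : Set ℝ}

/-- The quantized window of length `l` that starts at time `i`. -/
noncomputable def quantizedWindow (hX𝒳 : ∀ i ω, X i ω ∈ 𝒳) (b l i : ℕ) (ω : Ω) :
    Fin l → quantizedAlphabet 𝒳 b :=
  fun j => ⟨quantize b (X (i + j) ω), X (i + j) ω, hX𝒳 _ _, rfl⟩

lemma quantizedWindow_eq_iff (hX𝒳 : ∀ i ω, X i ω ∈ 𝒳) {b l i : ℕ} {ω : Ω}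
    {a : Fin l → quantizedAlphabet 𝒳 b} :
    quantizedWindow hX𝒳 b l i ω = a ↔ ∀ j : Fin l, quantize b (X (i + j) ω) = a j := by
  simp [funext_iff, quantizedWindow, Subtype.ext_iff]

lemma measurable_quantizedWindow (hXmeas : ∀ i, Measurable (X i)) (hX𝒳 : ∀ i ω, X i ω ∈ 𝒳)
    (b l i : ℕ) : Measurable (quantizedWindow hX𝒳 b l i) :=
  measurable_pi_iff.2 fun _ => ((measurable_quantize b).comp (hXmeas _)).subtype_mk

lemma measurableSet_sigmaGen_quantizedWindow (hX𝒳 : ∀ i ω, X i ω ∈ 𝒳) {b l i : ℕ} {I : Set ℕ}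
    (hI : ∀ j < l, i + j ∈ I) (a : Fin l → quantizedAlphabet 𝒳 b) :
    MeasurableSet[sigmaGen X I] {ω | quantizedWindow hX𝒳 b l i ω = a} := by
  have e : {ω | quantizedWindow hX𝒳 b l i ω = a} =
      ⋂ j : Fin l, X (i + j) ⁻¹' (quantize b ⁻¹' {(a j : ℝ)}) := by
    ext ω
    simp [quantizedWindow_eq_iff]
  rw [e]
  refine MeasurableSet.iInter fun j => ?_
  have h : MeasurableSpace.comap (X (i + j)) inferInstance ≤ sigmaGen X I :=
    le_iSup₂_of_le (i + j) (hI j j.2) le_rfl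
  exact h _ ⟨_, measurable_quantize b (measurableSet_singleton _), rfl⟩

lemma IsStationary.identDistrib_shift (h : IsStationary μ X) (i : ℕ) :
    IdentDistrib (fun ω (l : ℕ) => X (l + i) ω) (fun ω (l : ℕ) => X l ω) μ μ := by
  induction i with
  | zero => exact IdentDistrib.refl h.aemeasurable_snd
  | succ i ih =>
    have hu : Measurable fun (x : ℕ → ℝ) (l : ℕ) => x (l + 1) := by fun_prop
    have h1 := (ih.comp hu).trans h
    have e : ((fun (x : ℕ → ℝ) (l : ℕ) => x (l + 1)) ∘ fun ω (l : ℕ) => X (l + i) ω) =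
        fun ω (l : ℕ) => X (l + (i + 1)) ω := by
      funext ω l
      simp only [Function.comp_apply]
      congr 1
      omega
    rwa [e] at h1

lemma IsStationary.measureReal_quantizedWindow (h : IsStationary μ X)
    (hX𝒳 : ∀ i ω, X i ω ∈ 𝒳) (b l i : ℕ) (a : Fin l → quantizedAlphabet 𝒳 b) :
    μ.real {ω | quantizedWindow hX𝒳 b l i ω = a} = blockProb μ X b l fun j => a j := by
  have hs : MeasurableSet {x : ℕ → ℝ | ∀ j : Fin l, quantize b (x j) = a j} := by
    have e : {x : ℕ → ℝ | ∀ j : Fin l, quantize b (x j) = a j} =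
        ⋂ j : Fin l, (fun x : ℕ → ℝ => quantize b (x j)) ⁻¹' {(a j : ℝ)} := by
      ext x; simp
    rw [e]
    exact MeasurableSet.iInter fun j =>
      ((measurable_quantize b).comp (measurable_pi_apply _)) (measurableSet_singleton _)
  have h1 := (h.identDistrib_shift i).measure_mem_eq hs
  unfold blockProb Measure.real
  congr 1
  convert h1 using 2
  · ext ω
    simp [quantizedWindow_eq_iff, add_comm i]
  · rfl

lemma measure_inter_le_of_psiStar [IsFiniteMeasure μ] {g j : ℕ} {S T : Set Ω}
    (hS : MeasurableSet[sigmaGen X (Set.Iic j)] S)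
    (hT : MeasurableSet[sigmaGen X (Set.Ici (j + g))] T) :
    μ (S ∩ T) ≤ psiStar μ X g * (μ S * μ T) := by
  rcases eq_or_ne (μ S) 0 with h0 | h0
  · rw [measure_mono_null Set.inter_subset_left h0]; exact zero_le
  rcases eq_or_ne (μ T) 0 with h1 | h1
  · rw [measure_mono_null Set.inter_subset_right h1]; exact zero_le
  rw [← ENNReal.div_le_iff (mul_ne_zero h0 h1)
    (ENNReal.mul_ne_top (measure_ne_top _ _) (measure_ne_top _ _))]
  refine le_iSup_of_le j (le_iSup_of_le S (le_iSup_of_le T (le_iSup_of_le ?_ le_rfl)))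
  exact ⟨hS, hT, pos_iff_ne_zero.2 h0, pos_iff_ne_zero.2 h1⟩

/-- The first window ends at time `i + k`, so a distance `k + g` between starting points leaves the
gap `g` seen by `ψ*`. The bound is uniform in `b`, since quantization only shrinks σ-algebras. -/
lemma measureReal_quantizedWindow_pair_le [IsProbabilityMeasure μ] (hstat : IsStationary μ X)
    (hX𝒳 : ∀ i ω, X i ω ∈ 𝒳) {ε : ℝ} (hε : 0 ≤ ε) {g : ℕ}
    (hg : psiStar μ X g ≤ ENNReal.ofReal (1 + ε)) (b k : ℕ) {i j : ℕ} (hij : i + (k + g) ≤ j)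
    (a c : Fin (k + 1) → quantizedAlphabet 𝒳 b) :
    μ.real {ω | quantizedWindow hX𝒳 b (k + 1) i ω = a ∧ quantizedWindow hX𝒳 b (k + 1) j ω = c} ≤
      (1 + ε) * (blockProb μ X b (k + 1) (fun j => a j) *
        blockProb μ X b (k + 1) (fun j => c j)) := by
  have h := measure_inter_le_of_psiStar (μ := μ) (X := X) (g := g) (j := i + k)
    (measurableSet_sigmaGen_quantizedWindow hX𝒳 (i := i)
      (fun l hl => Set.mem_Iic.2 (by omega)) a)
    (measurableSet_sigmaGen_quantizedWindow hX𝒳 (i := j)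
      (fun l hl => Set.mem_Ici.2 (by omega)) c)
  rw [← hstat.measureReal_quantizedWindow hX𝒳 b (k + 1) i a,
    ← hstat.measureReal_quantizedWindow hX𝒳 b (k + 1) j c]
  unfold Measure.real
  rw [← ENNReal.toReal_mul, ← ENNReal.toReal_ofReal (show 0 ≤ 1 + ε by linarith),
    ← ENNReal.toReal_mul]
  refine ENNReal.toReal_mono (ENNReal.mul_ne_top ENNReal.ofReal_ne_top
    (ENNReal.mul_ne_top (measure_ne_top _ _) (measure_ne_top _ _))) ?_
  exact h.trans (by gcongr)

/-! ### Conditional information content and feasibility -/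

section Information

variable [IsProbabilityMeasure μ]

lemma blockProb_nonneg (b l : ℕ) (a : Fin l → ℝ) : 0 ≤ blockProb μ X b l a := measureReal_nonneg

lemma blockProb_le_one (b l : ℕ) (a : Fin l → ℝ) : blockProb μ X b l a ≤ 1 := measureReal_le_one

lemma blockProb_succ_le (b k : ℕ) (a : Fin (k + 1) → ℝ) :
    blockProb μ X b (k + 1) a ≤ blockProb μ X b k (Fin.init a) :=
  measureReal_mono fun _ hω i => hω i.castSucc

lemma condProb_nonneg (b k : ℕ) (a : Fin (k + 1) → ℝ) : 0 ≤ condProb μ X b k a :=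
  div_nonneg (blockProb_nonneg _ _ _) (blockProb_nonneg _ _ _)

lemma condProb_le_one (b k : ℕ) (a : Fin (k + 1) → ℝ) : condProb μ X b k a ≤ 1 :=
  div_le_one_of_le₀ (blockProb_succ_le _ _ _) (blockProb_nonneg _ _ _)

lemma blockProb_le_condProb (b k : ℕ) (a : Fin (k + 1) → ℝ) :
    blockProb μ X b (k + 1) a ≤ condProb μ X b k a := by
  rcases (blockProb_nonneg (μ := μ) (X := X) b (k + 1) a).eq_or_lt with h | h
  · rw [← h]; exact condProb_nonneg _ _ _
  · have h1 : 0 < blockProb μ X b k (Fin.init a) := h.trans_le (blockProb_succ_le _ _ _)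
    unfold condProb
    rw [le_div_iff₀ h1]
    exact mul_le_of_le_one_right h.le (blockProb_le_one _ _ _)

/-- The conditional information content of a word; a real-valued version of `weight`. -/
noncomputable def infoContent (μ : Measure Ω) (X : ℕ → Ω → ℝ) (b k : ℕ) (a : Fin (k + 1) → ℝ) :
    ℝ :=
  Real.logb 2 (1 / condProb μ X b k a)

lemma infoContent_nonneg (b k : ℕ) (a : Fin (k + 1) → ℝ) : 0 ≤ infoContent μ X b k a := by
  unfold infoContent
  rcases (condProb_nonneg (μ := μ) (X := X) b k a).eq_or_lt with h | h
  -- When the conditional probability is zero, `1 / 0 = 0` and `logb 2 0 = 0`: the real version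
  -- takes the value `0` where `weight` is infinite.
  · rw [← h]; simp
  · exact Real.logb_nonneg one_lt_two (by rw [le_div_iff₀ h, one_mul]; exact condProb_le_one _ _ _)

lemma weight_of_blockProb_ne_zero {b k : ℕ} {a : Fin (k + 1) → ℝ}
    (h : blockProb μ X b (k + 1) a ≠ 0) :
    weight μ X b k a = ENNReal.ofReal (infoContent μ X b k a) := by
  have h1 : condProb μ X b k a ≠ 0 :=
    (((blockProb_nonneg _ _ _).lt_of_ne' h).trans_le (blockProb_le_condProb _ _ _)).ne'
  rw [weight, if_neg h1]
  rfl

variable {b : ℕ} [Fintype (quantizedAlphabet 𝒳 b)]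

lemma condEntropy_eq_sum (k : ℕ) :
    condEntropy μ X 𝒳 b k = ∑ a : Fin (k + 1) → quantizedAlphabet 𝒳 b,
      blockProb μ X b (k + 1) (fun i => (a i : ℝ)) * infoContent μ X b k fun i => (a i : ℝ) := by
  unfold condEntropy infoContent
  rw [tsum_fintype, ← Finset.sum_neg_distrib]
  refine Finset.sum_congr rfl fun a _ => ?_
  rw [one_div, Real.logb_inv]
  ring

lemma sum_blockProb (hstat : IsStationary μ X) (hXmeas : ∀ i, Measurable (X i))
    (hX𝒳 : ∀ i ω, X i ω ∈ 𝒳) (l : ℕ) :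
    ∑ a : Fin l → quantizedAlphabet 𝒳 b, blockProb μ X b l (fun i => (a i : ℝ)) = 1 := by
  have h := integral_comp_of_fintype (μ := μ) (measurable_quantizedWindow hXmeas hX𝒳 b l 0)
    fun _ => 1
  simpa [hstat.measureReal_quantizedWindow hX𝒳] using h.symm

/-- A word's conditional probability is at least its block probability, so its conditional
information is at most its block information, whose second moment is controlled by the alphabet
size. -/
lemma sum_infoContent_sq_le (hstat : IsStationary μ X) (hXmeas : ∀ i, Measurable (X i))
    (hX𝒳 : ∀ i ω, X i ω ∈ 𝒳) (k : ℕ) :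
    ∑ a : Fin (k + 1) → quantizedAlphabet 𝒳 b, blockProb μ X b (k + 1) (fun i => (a i : ℝ)) *
        infoContent μ X b k (fun i => (a i : ℝ)) ^ 2 ≤
      (4 * ((k + 1) * Real.log (Fintype.card (quantizedAlphabet 𝒳 b))) ^ 2 + 16) /
        Real.log 2 ^ 2 := by
  obtain ⟨ω⟩ := μ.nonempty_of_neZero
  have : Nonempty (Fin (k + 1) → quantizedAlphabet 𝒳 b) := ⟨quantizedWindow hX𝒳 b (k + 1) 0 ω⟩
  have h := sum_mul_log_sq_le (α := Fin (k + 1) → quantizedAlphabet 𝒳 b)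
    (p := fun a => blockProb μ X b (k + 1) fun i => (a i : ℝ))
    (fun a => blockProb_nonneg _ _ _) (fun a => blockProb_le_one _ _ _)
    (sum_blockProb hstat hXmeas hX𝒳 (k + 1))
  have hcard : Real.log (Fintype.card (Fin (k + 1) → quantizedAlphabet 𝒳 b)) =
      (k + 1) * Real.log (Fintype.card (quantizedAlphabet 𝒳 b)) := by
    rw [Fintype.card_fun, Fintype.card_fin, Nat.cast_pow, Real.log_pow]
    push_cast; rfl
  rw [hcard] at h
  have hlog2 : 0 < Real.log 2 := Real.log_pos one_lt_two
  rw [le_div_iff₀ (by positivity), Finset.sum_mul]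
  refine (Finset.sum_le_sum fun a _ => ?_).trans h
  set p := blockProb μ X b (k + 1) fun i => (a i : ℝ)
  rcases (blockProb_nonneg (μ := μ) (X := X) b (k + 1) fun i => (a i : ℝ)).eq_or_lt with hp | hp
  · have : p = 0 := hp.symm
    rw [this]; simp
  · have hp : 0 < p := hp
    have h1 : p ≤ condProb μ X b k fun i => (a i : ℝ) := blockProb_le_condProb _ _ _
    have h2 : infoContent μ X b k (fun i => (a i : ℝ)) * Real.log 2 ≤ Real.log (1 / p) := by
      unfold infoContent Real.logb
      rw [div_mul_cancel₀ _ hlog2.ne']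
      refine Real.log_le_log (one_div_pos.2 (hp.trans_le h1)) ?_
      exact one_div_le_one_div_of_le hp h1
    rw [mul_assoc, ← mul_pow]
    have h3 := mul_nonneg (infoContent_nonneg (μ := μ) (X := X) b k fun i => (a i : ℝ)) hlog2.le
    gcongr

/-- The quantized source is feasible as soon as its empirical information content is small. -/
lemma quantizeVec_block_mem_feasible (hX𝒳 : ∀ i ω, X i ω ∈ 𝒳) {k n : ℕ} (hkn : k < n) {γ : ℝ}
    {ω : Ω}
    (hpos : ∀ i, blockProb μ X b (k + 1) (fun j => quantizedWindow hX𝒳 b (k + 1) i ω j) ≠ 0)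
    (hγ : ∑ i ∈ Finset.range (n - k),
      infoContent μ X b k (fun j => quantizedWindow hX𝒳 b (k + 1) i ω j) ≤ (n - k : ℕ) * γ) :
    quantizeVec b (block X n ω) ∈ feasible μ X 𝒳 b k n γ := by
  classical
  refine ⟨fun i => ⟨X i ω, hX𝒳 _ _, rfl⟩, ?_⟩
  set u := quantizeVec b (block X n ω) with hu
  have hN : (0 : ℝ) < (n : ℝ) - k := sub_pos.2 (by exact_mod_cast hkn)
  have hNcast : ((n - k : ℕ) : ℝ) = (n : ℝ) - k := Nat.cast_sub hkn.le
  have hemp : ∀ a : Fin (k + 1) → quantizedAlphabet 𝒳 b, empirical k u (fun i => (a i : ℝ)) =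
      (∑ i ∈ Finset.range (n - k),
        if quantizedWindow hX𝒳 b (k + 1) i ω = a then 1 else 0) / ((n : ℝ) - k) := by
    intro a
    unfold empirical
    congr 1
    rw [Finset.sum_range, Finset.card_filter]
    push_cast
    refine Finset.sum_congr rfl fun i _ => ?_
    have : (∀ j : Fin (k + 1), u ⟨i.1 + j.1, by omega⟩ = a j) ↔
        quantizedWindow hX𝒳 b (k + 1) i ω = a := (quantizedWindow_eq_iff hX𝒳).symm
    simp only [this]
  have hemp0 : ∀ a : Fin (k + 1) → quantizedAlphabet 𝒳 b,
      0 ≤ empirical k u (fun i => (a i : ℝ)) := by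
    intro a
    rw [hemp]
    exact div_nonneg (Finset.sum_nonneg fun i _ => by split_ifs <;> norm_num) hN.le
  have hterm : ∀ a : Fin (k + 1) → quantizedAlphabet 𝒳 b,
      weight μ X b k (fun i => (a i : ℝ)) *
        ENNReal.ofReal (empirical k u (fun i => (a i : ℝ))) =
      ENNReal.ofReal (infoContent μ X b k (fun i => (a i : ℝ)) *
        empirical k u (fun i => (a i : ℝ))) := by
    intro a
    by_cases h : ∃ i, quantizedWindow hX𝒳 b (k + 1) i ω = a
    · obtain ⟨i, rfl⟩ := h
      rw [weight_of_blockProb_ne_zero (hpos i), ENNReal.ofReal_mul (infoContent_nonneg _ _ _)]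
    -- Words that do not occur have frequency zero, and `∞ * 0 = 0` discards a possibly infinite
    -- weight.
    · have h0 : empirical k u (fun i => (a i : ℝ)) = 0 := by
        rw [hemp, Finset.sum_eq_zero, zero_div]
        exact fun i _ => if_neg fun hi => h ⟨i, hi⟩
      rw [h0]; simp
  unfold cost
  rw [tsum_fintype]
  simp_rw [hterm]
  rw [← ENNReal.ofReal_sum_of_nonneg fun a _ => mul_nonneg (infoContent_nonneg _ _ _) (hemp0 a)]
  refine ENNReal.ofReal_le_ofReal ?_
  have hsum : ∑ a : Fin (k + 1) → quantizedAlphabet 𝒳 b,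
      infoContent μ X b k (fun i => (a i : ℝ)) * empirical k u (fun i => (a i : ℝ)) =
      (∑ i ∈ Finset.range (n - k),
        infoContent μ X b k (fun j => quantizedWindow hX𝒳 b (k + 1) i ω j)) / ((n : ℝ) - k) := by
    simp_rw [hemp, mul_div_assoc', Finset.mul_sum]
    rw [← Finset.sum_div, Finset.sum_comm]
    congr 1
    refine Finset.sum_congr rfl fun i _ => ?_
    simp
  rw [hsum, div_le_iff₀ hN, ← hNcast]
  linarith

end Information

end QMAP

namespace QMAP

/-! ### The quantized source is feasible with high probability -/

variable {Ω : Type*} [MeasurableSpace Ω] {μ : Measure Ω} {X : ℕ → Ω → ℝ} {𝒳 : Set ℝ}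

lemma tendsto_zero_of_eventually_le_ofReal {u : ℕ → ℝ≥0∞}
    (h : ∀ η : ℝ, 0 < η → ∀ᶠ n in atTop, u n ≤ ENNReal.ofReal η) :
    Tendsto u atTop (𝓝 0) := by
  rw [ENNReal.tendsto_nhds_zero]
  intro ε hε
  have h1 : min ε 1 ≠ ⊤ := (min_le_right ε 1).trans_lt ENNReal.one_lt_top |>.ne
  have h2 : 0 < min ε 1 := lt_min hε one_pos
  filter_upwards [h (min ε 1).toReal (ENNReal.toReal_pos h2.ne' h1)] with n hn
  rw [ENNReal.ofReal_toReal h1] at hn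
  exact hn.trans (min_le_left _ _)

section Source

variable [IsProbabilityMeasure μ]

lemma exists_sum_infoContent_sq_le (h𝒳 : Bornology.IsBounded 𝒳) (hstat : IsStationary μ X)
    (hXmeas : ∀ i, Measurable (X i)) (hX𝒳 : ∀ i ω, X i ω ∈ 𝒳) (k : ℕ) :
    ∃ C : ℝ, 0 < C ∧ ∀ b : ℕ, 1 ≤ b → ∀ [Fintype (quantizedAlphabet 𝒳 b)],
      ∑ a : Fin (k + 1) → quantizedAlphabet 𝒳 b, blockProb μ X b (k + 1) (fun i => (a i : ℝ)) *
        infoContent μ X b k (fun i => (a i : ℝ)) ^ 2 ≤ C * (b : ℝ) ^ 2 := by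
  obtain ⟨R, hR⟩ := exists_card_quantizedAlphabet_le h𝒳
  have hlog2 : 0 < Real.log 2 := Real.log_pos one_lt_two
  set L : ℝ := Real.log (2 * R + 1) + Real.log 2 with hL
  have hR0 : 0 ≤ Real.log (2 * R + 1) := Real.log_nonneg (by linarith [R.cast_nonneg (α := ℝ)])
  refine ⟨(4 * ((k + 1) * L) ^ 2 + 16) / Real.log 2 ^ 2, by positivity, fun b hb _ => ?_⟩
  refine (sum_infoContent_sq_le hstat hXmeas hX𝒳 k).trans ?_
  have hb1 : (1 : ℝ) ≤ b := by exact_mod_cast hb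
  have hcard : (Fintype.card (quantizedAlphabet 𝒳 b) : ℝ) ≤ (2 * R + 1) * 2 ^ b := by
    rw [← Nat.card_eq_fintype_card, Nat.card_coe_set_eq]
    exact_mod_cast (hR b).2
  obtain ⟨ω⟩ := μ.nonempty_of_neZero
  have : Nonempty (quantizedAlphabet 𝒳 b) := ⟨⟨_, X 0 ω, hX𝒳 0 ω, rfl⟩⟩
  have hpos : (1 : ℝ) ≤ Fintype.card (quantizedAlphabet 𝒳 b) := by
    exact_mod_cast Fintype.card_pos
  have hlog : Real.log (Fintype.card (quantizedAlphabet 𝒳 b)) ≤ b * L := by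
    calc _ ≤ Real.log ((2 * R + 1) * 2 ^ b) := Real.log_le_log (by linarith) hcard
      _ = Real.log (2 * R + 1) + b * Real.log 2 := by
        rw [Real.log_mul (by positivity) (by positivity), Real.log_pow]
      _ ≤ b * L := by rw [hL]; nlinarith
  have hlog0 := Real.log_nonneg hpos
  rw [div_mul_eq_mul_div]
  gcongr
  calc 4 * ((k + 1) * Real.log (Fintype.card (quantizedAlphabet 𝒳 b))) ^ 2 + 16
      ≤ 4 * ((k + 1) * (b * L)) ^ 2 + 16 * (b : ℝ) ^ 2 := by
        have : (1 : ℝ) ≤ (b : ℝ) ^ 2 := one_le_pow₀ hb1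
        gcongr
        linarith
    _ = _ := by ring

lemma condEntropy_nonneg (h𝒳 : Bornology.IsBounded 𝒳) (b k : ℕ) :
    0 ≤ condEntropy μ X 𝒳 b k := by
  obtain ⟨R, hR⟩ := exists_card_quantizedAlphabet_le h𝒳
  have := (hR b).1.fintype
  rw [condEntropy_eq_sum]
  exact Finset.sum_nonneg fun a _ => mul_nonneg (blockProb_nonneg _ _ _) (infoContent_nonneg _ _ _)

/-- Without boundedness the real `limsup` could be a default value. It follows from the second
moment through `ι b ≤ ι² + b²`, averaged over words. -/
lemma isBoundedUnder_condEntropy_div (h𝒳 : Bornology.IsBounded 𝒳) (hstat : IsStationary μ X)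
    (hXmeas : ∀ i, Measurable (X i)) (hX𝒳 : ∀ i ω, X i ω ∈ 𝒳) (k : ℕ) :
    IsBoundedUnder (· ≤ ·) atTop fun b : ℕ => condEntropy μ X 𝒳 b k / b := by
  obtain ⟨C, hC, h⟩ := exists_sum_infoContent_sq_le h𝒳 hstat hXmeas hX𝒳 k
  obtain ⟨R, hR⟩ := exists_card_quantizedAlphabet_le h𝒳
  refine isBoundedUnder_of_eventually_le (a := C + 1) ?_
  filter_upwards [eventually_ge_atTop 1] with b hb
  have := (hR b).1.fintype
  have hb0 : (0 : ℝ) < b := by exact_mod_cast hb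
  have h1 := h b hb
  rw [condEntropy_eq_sum, div_le_iff₀ hb0]
  refine le_of_mul_le_mul_right ?_ hb0
  calc _ ≤ ∑ a : Fin (k + 1) → quantizedAlphabet 𝒳 b,
        (blockProb μ X b (k + 1) (fun i => (a i : ℝ)) *
          infoContent μ X b k (fun i => (a i : ℝ)) ^ 2 +
        blockProb μ X b (k + 1) (fun i => (a i : ℝ)) * (b : ℝ) ^ 2) := by
        rw [Finset.sum_mul]
        refine Finset.sum_le_sum fun a _ => ?_
        rw [mul_assoc, ← mul_add]
        refine mul_le_mul_of_nonneg_left ?_ (blockProb_nonneg _ _ _)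
        nlinarith [sq_nonneg (infoContent μ X b k (fun i => (a i : ℝ)) - b),
          infoContent_nonneg (μ := μ) (X := X) b k fun i => (a i : ℝ)]
    _ ≤ C * (b : ℝ) ^ 2 + 1 * (b : ℝ) ^ 2 := by
        rw [Finset.sum_add_distrib, ← Finset.sum_mul, sum_blockProb hstat hXmeas hX𝒳 (k + 1)]
        gcongr
    _ = (C + 1) * b * b := by ring

lemma upperInfoDim_nonneg (h𝒳 : Bornology.IsBounded 𝒳) (hstat : IsStationary μ X)
    (hXmeas : ∀ i, Measurable (X i)) (hX𝒳 : ∀ i ω, X i ω ∈ 𝒳) (k : ℕ) :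
    0 ≤ upperInfoDim μ X 𝒳 k :=
  le_limsup_of_frequently_le
    (Frequently.of_forall fun b => div_nonneg (condEntropy_nonneg h𝒳 b k) b.cast_nonneg)
    (isBoundedUnder_condEntropy_div h𝒳 hstat hXmeas hX𝒳 k)

/-- The quantized source is feasible with probability tending to one. -/
lemma tendsto_measure_quantizeVec_notMem_feasible (h𝒳 : Bornology.IsBounded 𝒳)
    (hmix : IsPsiStarMixing μ X) (hXmeas : ∀ i, Measurable (X i)) (hX𝒳 : ∀ i ω, X i ω ∈ 𝒳)
    (k : ℕ) {δ : ℝ} (hδ : 0 < δ) {β : ℕ → ℕ} (hβ : Tendsto β atTop atTop) :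
    Tendsto (fun n => μ {ω | ¬ quantizeVec (β n) (block X n ω) ∈
      feasible μ X 𝒳 (β n) k n (β n * (upperInfoDim μ X 𝒳 k + δ))}) atTop (𝓝 0) := by
  obtain ⟨hstat, hψ⟩ := hmix
  obtain ⟨C, hC, hK⟩ := exists_sum_infoContent_sq_le h𝒳 hstat hXmeas hX𝒳 k
  obtain ⟨R, hR⟩ := exists_card_quantizedAlphabet_le h𝒳
  refine tendsto_zero_of_eventually_le_ofReal fun η hη => ?_
  -- Chosen so that Chebyshev's bound `2 ε C b² / (b δ / 2)²` equals `η`; the powers of `b` cancel.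
  set ε : ℝ := η * δ ^ 2 / (8 * C) with hε
  have hε0 : 0 < ε := by positivity
  -- The gap depends on `ε` only, not on `n` or `b`, so close pairs become negligible as `n` grows.
  obtain ⟨g, hg⟩ := (hψ.eventually_le_const (show (1 : ℝ≥0∞) < ENNReal.ofReal (1 + ε) by
    rw [← ENNReal.ofReal_one]
    exact (ENNReal.ofReal_lt_ofReal_iff (by linarith)).2 (by linarith))).exists
  -- Half of `δ` absorbs the passage from the limsup to the entropy at level `b`; the other half is
  -- the Chebyshev deviation.
  have hent : ∀ᶠ n in atTop, condEntropy μ X 𝒳 (β n) k / β n < upperInfoDim μ X 𝒳 k + δ / 2 :=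
    hβ.eventually (eventually_lt_of_limsup_lt (lt_add_of_pos_right _ (half_pos hδ))
      (isBoundedUnder_condEntropy_div h𝒳 hstat hXmeas hX𝒳 k))
  have hN : ∀ᶠ n : ℕ in atTop, 2 * ((k + g : ℕ) : ℝ) / ((n - k : ℕ) : ℝ) ≤ ε := by
    have h1 : Tendsto (fun n : ℕ => ((n - k : ℕ) : ℝ)) atTop atTop :=
      tendsto_natCast_atTop_atTop.comp (tendsto_sub_atTop_nat k)
    exact (h1.const_div_atTop (2 * ((k + g : ℕ) : ℝ))).eventually_le_const hε0
  filter_upwards [hent, hN, hβ.eventually_ge_atTop 1, eventually_gt_atTop k] with n h1 h2 h3 hkn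
  set b := β n
  have := (hR b).1.fintype
  have hb0 : (0 : ℝ) < b := by exact_mod_cast h3
  rw [div_lt_iff₀ hb0, condEntropy_eq_sum] at h1
  have hcheb := measure_sum_gt_le (μ := μ) (V := quantizedWindow hX𝒳 b (k + 1))
    (p := fun a => blockProb μ X b (k + 1) fun i => (a i : ℝ))
    (φ := fun a => infoContent μ X b k fun i => (a i : ℝ)) (ε := ε) (G := k + g)
    (measurable_quantizedWindow hXmeas hX𝒳 b (k + 1))
    (fun i a => hstat.measureReal_quantizedWindow hX𝒳 b (k + 1) i a)
    (fun a => infoContent_nonneg _ _ _) hε0.le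
    (fun i j hij a c => measureReal_quantizedWindow_pair_le hstat hX𝒳 hε0.le hg b k hij a c)
    (N := n - k) (by omega) (s := b * (δ / 2)) (by positivity)
  -- Almost surely no null word ever occurs, so no infinite weight is charged.
  have hae : ∀ᵐ ω ∂μ, ∀ i,
      blockProb μ X b (k + 1) (fun j => quantizedWindow hX𝒳 b (k + 1) i ω j) ≠ 0 := by
    refine ae_all_iff.2 fun i => ?_
    have h : ∀ a : Fin (k + 1) → quantizedAlphabet 𝒳 b,
        ∀ᵐ ω ∂μ, quantizedWindow hX𝒳 b (k + 1) i ω = a →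
          blockProb μ X b (k + 1) (fun j => (a j : ℝ)) ≠ 0 := by
      intro a
      by_cases h0 : blockProb μ X b (k + 1) (fun j => (a j : ℝ)) = 0
      · have h4 := hstat.measureReal_quantizedWindow hX𝒳 b (k + 1) i a
        rw [h0, measureReal_eq_zero_iff] at h4
        filter_upwards [measure_eq_zero_iff_ae_notMem.1 h4] with ω hω hω'
        exact absurd hω' hω
      · exact ae_of_all _ fun _ _ => h0
    filter_upwards [ae_all_iff.2 h] with ω hω
    exact hω _ rfl
  calc _ ≤ μ {ω | ¬ ∑ i ∈ Finset.range (n - k),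
        infoContent μ X b k (fun j => quantizedWindow hX𝒳 b (k + 1) i ω j) ≤ (n - k : ℕ) *
        (∑ a : Fin (k + 1) → quantizedAlphabet 𝒳 b, blockProb μ X b (k + 1) (fun i => (a i : ℝ)) *
          infoContent μ X b k (fun i => (a i : ℝ)) + b * (δ / 2))} := by
        refine measure_mono_ae ?_
        filter_upwards [hae] with ω hω hnot hle
        refine hnot (quantizeVec_block_mem_feasible hX𝒳 hkn hω (hle.trans ?_))
        refine mul_le_mul_of_nonneg_left ?_ (Nat.cast_nonneg _)
        linarith
    _ ≤ _ := hcheb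
    _ ≤ _ := by
        refine ENNReal.ofReal_le_ofReal ?_
        rw [div_le_iff₀ (by positivity)]
        calc _ ≤ (ε + ε) * (C * (b : ℝ) ^ 2) := by
              refine mul_le_mul (by linarith) (hK b h3) ?_ (by positivity)
              exact Finset.sum_nonneg fun a _ => mul_nonneg (blockProb_nonneg _ _ _) (sq_nonneg _)
          _ = _ := by rw [hε]; field_simp; ring

end Source

/-! ### Error recursion and limits -/

lemma tendsto_bits {r : ℝ} (hr : 0 < r) : Tendsto (bits r) atTop atTop := by
  have h : Tendsto (Real.logb 2) atTop atTop := Real.tendsto_logb_atTop one_lt_two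
  exact tendsto_nat_ceil_atTop.comp ((h.comp (h.comp tendsto_natCast_atTop_atTop)).const_mul_atTop hr)

/-- The deterministic error recursion on the good event. -/
lemma IsPGDRun.error_recursion {m n : ℕ} (hm : 0 < m) (hn : 0 < n)
    {F : Set (EuclideanSpace ℝ (Fin n))} {A : Matrix (Fin m) (Fin n) ℝ} {z : Fin m → ℝ}
    {x : ℕ → EuclideanSpace ℝ (Fin n)} {x₀ : EuclideanSpace ℝ (Fin n)} {b : ℕ} {σ s : ℝ}
    (hσ : 0 ≤ σ) (hs : 1 / 9 ≤ s)
    (hq : quantizeVec b x₀ ∈ F) (hA : ‖gramDefect A ((n : ℝ) / m)‖ ≤ 2 / 5)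
    (hz : ‖WithLp.toLp 2 (Aᵀ *ᵥ z)‖ ≤ σ * (m / (36 * √(n : ℝ))))
    (hx : IsPGDRun F A (A *ᵥ x₀.ofLp + z) ((n : ℝ) / m) x) (t : ℕ) :
    1 / √(n : ℝ) * ‖x (t + 1) - quantizeVec b x₀‖ ≤
      0.9 / √(n : ℝ) * ‖x t - quantizeVec b x₀‖ +
        2 * (√(n : ℝ) + 2 * √(m : ℝ)) ^ 2 / m * (2 : ℝ) ^ (-(b : ℝ)) + σ / 2 * s := by
  have hm' : (0 : ℝ) < m := by exact_mod_cast hm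
  have hn' : (0 : ℝ) < √(n : ℝ) := Real.sqrt_pos.2 (by exact_mod_cast hn)
  have hnn : √(n : ℝ) * √(n : ℝ) = n := Real.mul_self_sqrt (Nat.cast_nonneg n)
  have h1 := hx.norm_sub_le (by positivity) hq hA t
  have h2 := norm_sub_quantizeVec_le b x₀
  set e := ‖x t - quantizeVec b x₀‖
  have he : 0 ≤ e := norm_nonneg _
  set w := (2 : ℝ) ^ (-(b : ℝ))
  have hw : 0 ≤ w := by positivity
  -- The term `2 √m` alone makes the coefficient on the right at least `8`.
  have h3 : (14 / 5 : ℝ) * w ≤ 2 * (√(n : ℝ) + 2 * √(m : ℝ)) ^ 2 / m * w := by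
    refine mul_le_mul_of_nonneg_right ?_ hw
    rw [le_div_iff₀ hm']
    have h4 : √(m : ℝ) * √(m : ℝ) = m := Real.mul_self_sqrt (Nat.cast_nonneg m)
    nlinarith [mul_nonneg hn'.le (Real.sqrt_nonneg (m : ℝ)), mul_self_nonneg (√(n : ℝ))]
  have h5 : (n : ℝ) / m * ‖WithLp.toLp 2 (Aᵀ *ᵥ z)‖ ≤ √(n : ℝ) * (σ / 36) := by
    calc _ ≤ (n : ℝ) / m * (σ * (m / (36 * √(n : ℝ)))) := by gcongr
      _ = √(n : ℝ) * √(n : ℝ) / m * (σ * (m / (36 * √(n : ℝ)))) := by rw [hnn]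
      _ = _ := by field_simp
  have h6 : ‖x (t + 1) - quantizeVec b x₀‖ ≤
      2 * (2 / 5 * e + (1 + 2 / 5) * (√(n : ℝ) * w) + √(n : ℝ) * (σ / 36)) :=
    h1.trans (by gcongr)
  have h7 : σ / 18 ≤ σ / 2 * s := by nlinarith
  have h8 : 4 / 5 * (1 / √(n : ℝ) * e) ≤ 0.9 / √(n : ℝ) * e := by
    have h9 : 0 ≤ 1 / √(n : ℝ) * e := by positivity
    have e9 : 0.9 / √(n : ℝ) * e = 0.9 * (1 / √(n : ℝ) * e) := by ring
    rw [e9]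
    norm_num
    norm_num at h9
    linarith
  calc _ ≤ 1 / √(n : ℝ) *
        (2 * (2 / 5 * e + (1 + 2 / 5) * (√(n : ℝ) * w) + √(n : ℝ) * (σ / 36))) := by gcongr
    _ = 4 / 5 * (1 / √(n : ℝ) * e) + 14 / 5 * w + σ / 18 := by field_simp; ring
    _ ≤ _ := by linarith

end QMAP

namespace QMAP

/-- The failure probability of the near isometry tends to zero when `m / n → ∞`. -/
lemma tendsto_gramDefect_bound {m : ℕ → ℕ} (hm : ∀ K : ℕ, ∀ᶠ n in atTop, K * n ≤ m n) :
    Tendsto (fun n => ENNReal.ofReal (9 ^ n * (2 * (199 / 200) ^ m n))) atTop (𝓝 0) := by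
  -- With `(199/200)^K < 1/18`, each of the `n` net factors `9` is beaten: `9 (199/200)^K ≤ 1/2`.
  obtain ⟨K, hK⟩ := exists_pow_lt_of_lt_one (show (0 : ℝ) < 1 / 18 by norm_num)
    (show (199 / 200 : ℝ) < 1 by norm_num)
  have h1 : Tendsto (fun n : ℕ => 2 * (1 / 2 : ℝ) ^ n) atTop (𝓝 0) := by
    simpa using (tendsto_pow_atTop_nhds_zero_of_lt_one (show (0 : ℝ) ≤ 1 / 2 by norm_num)
      (by norm_num)).const_mul 2
  have h2 : Tendsto (fun n : ℕ => (9 : ℝ) ^ n * (2 * (199 / 200) ^ m n)) atTop (𝓝 0) := by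
    refine squeeze_zero' (Eventually.of_forall fun n => by positivity) ?_ h1
    filter_upwards [hm K] with n hn
    calc (9 : ℝ) ^ n * (2 * (199 / 200) ^ m n) ≤ 9 ^ n * (2 * (199 / 200) ^ (K * n)) := by
          gcongr 9 ^ n * (2 * ?_)
          exact pow_le_pow_of_le_one (by norm_num) (by norm_num) hn
      _ = 2 * (9 * (199 / 200) ^ K) ^ n := by rw [mul_pow, ← pow_mul]; ring
      _ ≤ 2 * (1 / 2) ^ n := by
          gcongr
          linarith
  simpa using ENNReal.tendsto_ofReal h2

end QMAP

/-! ### The main theorem -/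

theorem mainTheorem8 {Ω : Type*} [MeasurableSpace Ω] (μ : Measure Ω) [IsProbabilityMeasure μ]
    -- the source: a `ψ*`-mixing stationary process with values in a bounded set
    (𝒳 : Set ℝ) (h𝒳 : Bornology.IsBounded 𝒳)
    (X : ℕ → Ω → ℝ) (hXmeas : ∀ i, Measurable (X i)) (hX𝒳 : ∀ i ω, X i ω ∈ 𝒳)
    (hmix : QMAP.IsPsiStarMixing μ X)
    -- the lower bound on the law of the first `k + 1` variables
    (k : ℕ)
    (hf : ∃ f : ℝ, 0 < f ∧ ∀ S : Set (Fin (k + 1) → ℝ), MeasurableSet S →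
      (∀ s ∈ S, ∀ i, s i ∈ 𝒳) →
      0 < μ {ω | (fun i : Fin (k + 1) => X i ω) ∈ S} →
      ENNReal.ofReal f * volume S ≤ μ {ω | (fun i : Fin (k + 1) => X i ω) ∈ S})
    -- the parameters; `m n` is `80 n b_n (d̄_k + δ)`, rounded to an integer
    (r : ℝ) (hr : 1 < r) (δ : ℝ) (hδ : 0 < δ) (σ : ℝ≥0)
    (m : ℕ → ℕ)
    (hm : ∀ n : ℕ,
      |(m n : ℝ) - 80 * n * QMAP.bits r n * (QMAP.upperInfoDim μ X 𝒳 k + δ)| < 1)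
    -- the design matrices, with i.i.d. `N(0, 1/n)` entries
    (A : ∀ n, Ω → Matrix (Fin (m n)) (Fin n) ℝ)
    (hAmeas : ∀ n i j, Measurable fun ω => A n ω i j)
    (hAlaw : ∀ n i j, μ.map (fun ω => A n ω i j) = gaussianReal 0 (n : ℝ≥0)⁻¹)
    (hAindep : ∀ n, iIndepFun (fun (p : Fin (m n) × Fin n) ω => A n ω p.1 p.2) μ)
    -- the noise vectors, with i.i.d. `N(0, σ²)` entries
    (Z : ∀ n, Ω → Fin (m n) → ℝ)
    (hZmeas : ∀ n i, Measurable fun ω => Z n ω i)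
    (hZlaw : ∀ n i, μ.map (fun ω => Z n ω i) = gaussianReal 0 (σ ^ 2))
    (hZindep : ∀ n, iIndepFun (fun (i : Fin (m n)) ω => Z n ω i) μ)
    -- for each `n`, the source, the design and the noise are independent
    (hAZ : ∀ n, IndepFun (fun ω (p : Fin (m n) × Fin n) => A n ω p.1 p.2) (Z n) μ)
    (hXAZ : ∀ n, IndepFun (fun ω (i : ℕ) => X i ω)
      (fun ω => ((fun p : Fin (m n) × Fin n => A n ω p.1 p.2), Z n ω)) μ) :
    -- the probability that the following fails tends to zero: the iteration can be run, and the
    -- error recursion holds in every iteration of every run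
    Tendsto (fun n : ℕ => μ {ω | ¬
      ((∃ x, QMAP.IsPGDRun
          (QMAP.feasible μ X 𝒳 (QMAP.bits r n) k n
            (QMAP.bits r n * (QMAP.upperInfoDim μ X 𝒳 k + δ)))
          (A n ω) (A n ω *ᵥ (QMAP.block X n ω).ofLp + Z n ω) ((n : ℝ) / m n) x) ∧
        ∀ x, QMAP.IsPGDRun
          (QMAP.feasible μ X 𝒳 (QMAP.bits r n) k n
            (QMAP.bits r n * (QMAP.upperInfoDim μ X 𝒳 k + δ)))
          (A n ω) (A n ω *ᵥ (QMAP.block X n ω).ofLp + Z n ω) ((n : ℝ) / m n) x →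
          ∀ t : ℕ, 1 ≤ t →
            1 / √(n : ℝ) * ‖x (t + 1) - QMAP.quantizeVec (QMAP.bits r n) (QMAP.block X n ω)‖ ≤
              0.9 / √(n : ℝ) * ‖x t - QMAP.quantizeVec (QMAP.bits r n) (QMAP.block X n ω)‖ +
              2 * (√(n : ℝ) + 2 * √(m n : ℝ)) ^ 2 / m n * (2 : ℝ) ^ (-(QMAP.bits r n : ℝ)) +
              σ / 2 * √(n * QMAP.bits r n * (QMAP.upperInfoDim μ X 𝒳 k + 3 * δ) / m n))})
      atTop (𝓝 0) := by
  have hstat := hmix.1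
  have hd0 := QMAP.upperInfoDim_nonneg h𝒳 hstat hXmeas hX𝒳 k
  set d := QMAP.upperInfoDim μ X 𝒳 k with hd
  set β := QMAP.bits r with hβdef
  have hβ : Tendsto β atTop atTop := QMAP.tendsto_bits (by linarith)
  have hβ' : Tendsto (fun n => (β n : ℝ)) atTop atTop := tendsto_natCast_atTop_atTop.comp hβ
  have hD : 0 < d + δ := by linarith
  -- `m / n` grows like `b`; the extra `1` in `K + 1` pays for the rounding of `m`.
  have hmK : ∀ K : ℕ, ∀ᶠ n in atTop, K * n ≤ m n := by
    intro K
    filter_upwards [hβ'.eventually_ge_atTop ((K + 1) / (80 * (d + δ))), eventually_ge_atTop 1]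
      with n h1 h2
    rw [div_le_iff₀ (by positivity)] at h1
    have h3 := (abs_lt.1 (hm n)).1
    have h4 : (1 : ℝ) ≤ n := by exact_mod_cast h2
    have h5 : (n : ℝ) * (K + 1) ≤ n * (β n * (80 * (d + δ))) := by gcongr
    have h6 : (K : ℝ) * n ≤ m n := by nlinarith
    exact_mod_cast h6
  have hfeas := QMAP.tendsto_measure_quantizeVec_notMem_feasible h𝒳 hmix hXmeas hX𝒳 k hδ hβ
  have hgram := QMAP.tendsto_gramDefect_bound hmK
  -- At the threshold `m / (36 √n)` the Markov bound is `1296 n / m`.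
  have hnoise : Tendsto (fun n : ℕ =>
      ENNReal.ofReal ((m n : ℝ) / (m n / (36 * √(n : ℝ))) ^ 2)) atTop (𝓝 0) := by
    refine QMAP.tendsto_zero_of_eventually_le_ofReal fun η hη => ?_
    obtain ⟨K, hK⟩ := exists_nat_ge (1296 / η)
    filter_upwards [hmK K, hmK 1, eventually_ge_atTop 1] with n h1 h2 h3
    refine ENNReal.ofReal_le_ofReal ?_
    have hn : (0 : ℝ) < n := by exact_mod_cast h3
    have hmn : (0 : ℝ) < m n := by exact_mod_cast (by omega : 0 < m n)
    have h4 : (K : ℝ) * n ≤ m n := by exact_mod_cast h1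
    rw [div_pow, mul_pow, Real.sq_sqrt hn.le]
    have e : (m n : ℝ) / ((m n : ℝ) ^ 2 / (36 ^ 2 * n)) = 1296 * n / m n := by
      field_simp; norm_num
    rw [e, div_le_iff₀ hmn]
    rw [div_le_iff₀ hη] at hK
    nlinarith
  have hsum := (hfeas.add hgram).add hnoise
  rw [add_zero, add_zero] at hsum
  refine tendsto_of_tendsto_of_tendsto_of_le_of_le' tendsto_const_nhds hsum
    (Eventually.of_forall fun n => zero_le) ?_
  filter_upwards [hmK 1, eventually_ge_atTop 1, hβ'.eventually_ge_atTop (1 / (d + δ))]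
    with n hmn1 hn1 hβn
  have hn : 0 < n := by omega
  have hmn : 0 < m n := by omega
  have hn' : (1 : ℝ) ≤ n := by exact_mod_cast hn1
  have hmn' : (0 : ℝ) < m n := by exact_mod_cast hmn
  -- Once `n b (d + δ) ≥ 1`, rounding gives `m ≤ 81 n b (d + δ)`, and `81 = 9²`. The noise term of
  -- the statement is then at least `σ / 18`, twice the `σ / 36` of the noise threshold.
  have hs : 1 / 9 ≤ √(n * β n * (d + 3 * δ) / m n) := by
    refine Real.le_sqrt_of_sq_le ?_
    rw [le_div_iff₀ hmn']
    rw [div_le_iff₀ hD] at hβn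
    have h1 := (abs_lt.1 (hm n)).2
    have h2 : (1 : ℝ) ≤ n * (β n * (d + δ)) := by nlinarith
    have h3 : (0 : ℝ) ≤ n * β n * (2 * δ) := by positivity
    nlinarith
  refine (measure_mono fun ω hω => ?_).trans ((measure_union_le _ _).trans (add_le_add
    ((measure_union_le _ _).trans (add_le_add le_rfl
      (QMAP.measure_gramDefect_gt_le hmn hn (hAmeas n) (hAlaw n) (hAindep n))))
    (QMAP.measure_transpose_mulVec_noise_le hn (hAmeas n) (hAlaw n) (hZmeas n) (hZlaw n)
      (hZindep n) (hAZ n) (c := m n / (36 * √(n : ℝ))) (by positivity))))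
  by_contra hnot
  simp only [Set.mem_union, Set.mem_ofPred_eq, not_or, not_not] at hnot
  obtain ⟨⟨hq, hA⟩, hz⟩ := hnot
  obtain ⟨R, hR⟩ := QMAP.exists_card_quantizedAlphabet_le h𝒳
  refine hω ⟨QMAP.exists_isPGDRun (QMAP.finite_feasible μ X (hR _).1 k n _) ⟨_, hq⟩ _ _ _, ?_⟩
  intro x hx t _
  exact hx.error_recursion hmn hn σ.2 hs hq hA hz t
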